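/- Let $m,n,r,e$ be fixed integers with $n\ge m\ge r\ge 3$ and $e\ge 2$. For a prime $p$, an $m\times n$ matrix $\mathbf f=(f_{i,j})$ of polynomials $f_{i,j}\in\mathbb F_p[X]$ and a positive integer $H$, let $L_{\mathbf f,r}(H,p)$ be the number of arrays of integers $(x_{i,j})_{1\le i\le m,\,1\le j\le n}$ with $-H\le x_{i,j}\le H$ for which the matrix $(f_{i,j}(x_{i,j}))_{1\le i\le m,\,1\le j\le n}$ has rank exactly $r$ over $\mathbb F_p$ (integers being reduced modulo $p$ before they are substituted). Put $$\Gamma(m,n,r)=\max\Bigl\{0,\; m-\frac{n+r}{2},\; m(r-1)-n-r(r-2)\Bigr\}.$$ Then for every $\varepsilon>0$ there is an $H_0$, depending only on $m,n,r,e,\varepsilon$, such that for every integer $H\ge H_0$, every prime $p$ with $H\le p^{2/(e(e+1))}$, and every $m\times n$ matrix $\mathbf f$ of polynomials $f_{i,j}\in\mathbb F_p[X]$ with $2\le \deg f_{i,j}\le e$ for all $i,j$, $$L_{\mathbf f,r}(H,p)\le H^{\,m+nr-r+\Gamma(m,n,r)+\varepsilon}.$$ -/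

import Mathlib

open Filter Polynomial

noncomputable section

/-- The matrix `(f_{i,j}(x_{i,j}))` over `F_p`, obtained by evaluating a matrix `f` of univariate
polynomials over `F_p`, each in its own variable, at the residues mod `p` of the integers
`x i j`. -/
def polyMatrixEval {p m n : ℕ} (f : Matrix (Fin m) (Fin n) (ZMod p)[X])
    (x : Fin m → Fin n → ℤ) : Matrix (Fin m) (Fin n) (ZMod p) :=
  Matrix.of fun i j => (f i j).eval (x i j : ZMod p)

/-- All `(2H+1)^{mn}` arrays of integers `x i j` in `[-H, H]`. -/
def intBox (m n H : ℕ) : Finset (Fin m → Fin n → ℤ) :=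
  Fintype.piFinset fun _ => Fintype.piFinset fun _ => Finset.Icc (-(H : ℤ)) (H : ℤ)

/-- `L_{f,r}(H,p)`: the number of choices of integers `x i j` in `[-H, H]` for which the matrix
`(f_{i,j}(x_{i,j}))` has rank exactly `r` over `F_p`. -/
def rankCount {p m n : ℕ} (f : Matrix (Fin m) (Fin n) (ZMod p)[X]) (r H : ℕ) : ℕ :=
  ((intBox m n H).filter fun x => (polyMatrixEval f x).rank = r).card

/-- `Γ(m,n,r) = max {0, m - (n+r)/2, m(r-1) - n - r(r-2)}`, a real number. -/
def gammaExponent (m n r : ℕ) : ℝ :=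
  max 0 (max ((m : ℝ) - ((n : ℝ) + r) / 2)
    ((m : ℝ) * ((r : ℝ) - 1) - n - (r : ℝ) * ((r : ℝ) - 2)))

end

/-! If `r = m`, the trivial count of the whole box already has exponent `mn`. Otherwise a matrix of
rank `r` has `r` independent rows `R` and `r` columns `J` onto which its row space projects
injectively. Every other row is a combination of the rows in `R`; let `i₀` be one with the largest
support `S`, and let `s` be the size of `S`. For fixed `(R, J, i₀, S)`, up to constants and
arbitrarily small powers of `H`: the `R × J` minor costs `H^(r^2)`; row `i₀` on `J` lies in the span
of `s` known vectors and costs `H^s`, and the coefficients of its relation are then determined; each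
of the `n - r` other columns, restricted to `R ∪ {i₀}`, satisfies this relation and costs
`H^(columnExponent r s)`; each of the `m - r - 1` other rows lies in the span of at most `s` known
rows and costs `H^s`. The cases `s ≤ 1`, `s = 2` and `s ≥ 3` produce the three terms of `Γ`
(`card_filter_isRankPattern_le`, `columnExponent_bound`).

The saving in a column comes from `exists_card_quadSols_le`: a four-term additive polynomial
equation mod `p` has at most `H^(2+ε)` solutions, up to a constant. By Cauchy–Schwarz this reduces
to the additive energy of one polynomial `f` on a short interval. For a solution of `f x + f y = f z
+ f w`, the vector of differences of power sums of degrees `1, ..., e` lies in a box and is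
orthogonal mod `p` to the coefficient vector of `f`. The condition on `H` makes every `e × e` minor
of such vectors smaller than `p`; being divisible by `p`, it vanishes. Hence all solutions also
satisfy one equation `g x + g y = g z + g w` over the integers, with controlled coefficients
(`exists_int_relation_of_small`). If `deg g ≥ 2`, the divisor bound applies, because `x - z` divides
`g x - g z`; if `deg g = 1`, then `x + y = z + w`, and finite differences of `f` finish the count.
-/

/-! ### The divisor bound. -/

/-- The divisor bound: the number of divisors of `n` is `O(n ^ ε)` for every `ε > 0`. -/
theorem exists_card_divisors_le_rpow {ε : ℝ} (hε : 0 < ε) :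
    ∃ C : ℝ, 1 ≤ C ∧ ∀ n : ℕ, n ≠ 0 → (n.divisors.card : ℝ) ≤ C * (n : ℝ) ^ ε := by
  obtain ⟨P, hP⟩ := exists_nat_ge ((2 : ℝ) ^ (1 / ε))
  -- `K` serves the primes below `P`: there `a + 1 ≤ K (1 + ε a log 2) ≤ K 2^(ε a)`. A prime `p ≥ P`
  -- has `p^ε ≥ 2`, so `a + 1 ≤ 2^a` needs no constant. The small primes contribute at most `K^P` in
  -- total.
  set K : ℝ := max 1 (1 / (ε * Real.log 2)) with hK
  have hlog : 0 < Real.log 2 := Real.log_pos (by norm_num)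
  have hK1 : 1 ≤ K := le_max_left _ _
  have hK2 : 1 ≤ K * (ε * Real.log 2) := by
    have h : 1 / (ε * Real.log 2) ≤ K := le_max_right _ _
    rwa [div_le_iff₀ (by positivity)] at h
  refine ⟨K ^ P, one_le_pow₀ hK1, fun n hn => ?_⟩
  have key : ∀ p ∈ n.primeFactors, ((n.factorization p + 1 : ℕ) : ℝ) ≤
      (if p < P then K else 1) * ((p : ℝ) ^ n.factorization p) ^ ε := by
    intro p hp
    have hp2 : (2 : ℝ) ≤ p := by exact_mod_cast (Nat.prime_of_mem_primeFactors hp).two_le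
    set a := n.factorization p
    have hcomm : ((p : ℝ) ^ a) ^ ε = ((p : ℝ) ^ ε) ^ a := by
      rw [← Real.rpow_natCast, ← Real.rpow_natCast, ← Real.rpow_mul (by positivity),
        ← Real.rpow_mul (by positivity), mul_comm]
    split_ifs with hpP
    · have h1 : (2 : ℝ) ^ (ε * a) ≤ ((p : ℝ) ^ a) ^ ε := by
        rw [hcomm, Real.rpow_mul (by norm_num), Real.rpow_natCast]
        gcongr
      have h2 : 1 + ε * a * Real.log 2 ≤ (2 : ℝ) ^ (ε * a) := by
        rw [Real.rpow_def_of_pos (by norm_num)]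
        have := Real.add_one_le_exp (Real.log 2 * (ε * a))
        linarith
      have h3 : (a : ℝ) * 1 ≤ a * (K * (ε * Real.log 2)) := by gcongr
      calc ((a + 1 : ℕ) : ℝ) ≤ K * (1 + ε * a * Real.log 2) := by
            push_cast; nlinarith
        _ ≤ _ := by gcongr; exact h2.trans h1
    · have h1 : (2 : ℝ) ≤ (p : ℝ) ^ ε := by
        have : (2 : ℝ) ^ (1 / ε) ≤ p := hP.trans (by exact_mod_cast not_lt.mp hpP)
        calc (2 : ℝ) = ((2 : ℝ) ^ (1 / ε)) ^ ε := by
              rw [← Real.rpow_mul (by norm_num), one_div_mul_cancel hε.ne', Real.rpow_one]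
          _ ≤ _ := by gcongr
      rw [hcomm, one_mul]
      calc ((a + 1 : ℕ) : ℝ) ≤ ((2 ^ a : ℕ) : ℝ) := by exact_mod_cast Nat.lt_two_pow_self
        _ = (2 : ℝ) ^ a := by push_cast; ring
        _ ≤ _ := by gcongr
  have hprod : (∏ p ∈ n.primeFactors, ((p : ℝ) ^ n.factorization p) ^ ε) = (n : ℝ) ^ ε := by
    rw [Real.finsetProd_rpow _ _ (fun _ _ => by positivity)]
    congr 1
    conv_rhs => rw [← Nat.prod_factorization_pow_eq_self hn]
    simp [Finsupp.prod]
  have hite : (∏ p ∈ n.primeFactors, if p < P then K else (1 : ℝ)) ≤ K ^ P := by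
    rw [Finset.prod_ite, Finset.prod_const, Finset.prod_const_one, mul_one]
    refine pow_le_pow_right₀ hK1 ?_
    calc _ ≤ (Finset.range P).card := Finset.card_le_card fun x hx => by simp at hx ⊢; exact hx.2
      _ = P := Finset.card_range P
  rw [Nat.card_divisors hn, Nat.cast_prod]
  calc _ ≤ ∏ p ∈ n.primeFactors, (if p < P then K else 1) * ((p : ℝ) ^ n.factorization p) ^ ε :=
        Finset.prod_le_prod (fun _ _ => by positivity) key
    _ ≤ _ := by
        rw [Finset.prod_mul_distrib, hprod]
        gcongr

/-! ### Fibres of polynomials and of their finite differences. -/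

/-- A nonzero polynomial of degree `d` vanishes at no more than `d` members of an injective
family. -/
theorem card_filter_eval_eq_zero_le {R α : Type*} [CommRing R] [IsDomain R] [DecidableEq R]
    {P : R[X]} (hP : P ≠ 0) (A : Finset α) {φ : α → R} (hφ : Set.InjOn φ A) :
    (A.filter fun x => P.eval (φ x) = 0).card ≤ P.natDegree := by
  refine le_trans ?_ ((Multiset.toFinset_card_le _).trans (card_roots' P))
  refine Finset.card_le_card_of_injOn φ (fun x hx => ?_)
    (hφ.mono (Finset.coe_subset.2 (Finset.filter_subset _ _)))
  simp only [Finset.coe_filter, Set.mem_ofPred_eq] at hx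
  simp [hP, hx.2]

theorem card_filter_eval_eq_le {R α : Type*} [CommRing R] [IsDomain R] [DecidableEq R]
    {P : R[X]} (hP : 1 ≤ P.natDegree) (A : Finset α) {φ : α → R} (hφ : Set.InjOn φ A) (c : R) :
    (A.filter fun x => P.eval (φ x) = c).card ≤ P.natDegree := by
  have h0 : P - C c ≠ 0 := fun h => by
    rw [sub_eq_zero.mp h, natDegree_C] at hP
    omega
  have h := card_filter_eval_eq_zero_le h0 A hφ
  simpa [sub_eq_zero] using h

/-- A finite difference of a polynomial of degree `d ≥ 2` takes any value at most `d` times. -/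
theorem card_filter_eval_add_sub_eval_le {R α : Type*} [CommRing R] [IsDomain R] [DecidableEq R]
    {P : R[X]} (hP : 2 ≤ P.natDegree) {h : R} (hh : (P.natDegree : R) * h ≠ 0)
    (A : Finset α) {φ : α → R} (hφ : Set.InjOn φ A) (c : R) :
    (A.filter fun x => P.eval (φ x + h) - P.eval (φ x) = c).card ≤ P.natDegree := by
  obtain ⟨d, hd⟩ : ∃ d, P.natDegree = d + 1 := ⟨P.natDegree - 1, by omega⟩
  -- The top coefficients cancel in `P(X + h) - P(X)`; the next one, in degree `deg P - 1 ≥ 1`, is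
  -- nonzero by `hh`, so the difference is not constant.
  have hcoeff : (taylor h P - P).coeff d = (P.natDegree : R) * h * P.leadingCoeff := by
    have hdeg : (hasseDeriv d P).natDegree < 2 := by
      have := natDegree_hasseDeriv_le P d
      omega
    rw [coeff_sub, taylor_coeff, eval_eq_sum_range' hdeg]
    simp [Finset.sum_range_succ, hasseDeriv_coeff, leadingCoeff, hd, Nat.add_comm 1 d]
    ring
  have hne : (taylor h P - P).coeff d ≠ 0 := by
    rw [hcoeff]
    refine mul_ne_zero hh ?_
    rw [Ne, leadingCoeff_eq_zero]
    rintro rfl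
    simp at hP
  have h1 : 1 ≤ (taylor h P - P).natDegree :=
    le_trans (by omega) (le_natDegree_of_ne_zero hne)
  have h2 : (taylor h P - P).natDegree ≤ P.natDegree :=
    (natDegree_sub_le _ _).trans (by simp)
  have := card_filter_eval_eq_le h1 A hφ c
  simp only [eval_sub, taylor_eval] at this
  exact this.trans h2

/-! ### From a congruence mod `p` to an equation over the integers. -/

/-- The Leibniz bound for a determinant with column-wise bounded entries. -/
theorem abs_det_le_factorial_mul_prod {n : ℕ} (A : Matrix (Fin n) (Fin n) ℤ) (B : Fin n → ℤ)
    (h : ∀ i j, |A i j| ≤ B j) : |A.det| ≤ n.factorial * ∏ j, B j := by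
  rw [Matrix.det_apply]
  calc |∑ σ : Equiv.Perm (Fin n), Equiv.Perm.sign σ • ∏ i, A (σ i) i|
      ≤ ∑ σ : Equiv.Perm (Fin n), |Equiv.Perm.sign σ • ∏ i, A (σ i) i| :=
        Finset.abs_sum_le_sum_abs _ _
    _ ≤ ∑ _σ : Equiv.Perm (Fin n), ∏ j, B j := by
        refine Finset.sum_le_sum fun σ _ => ?_
        have : |Equiv.Perm.sign σ • ∏ i, A (σ i) i| = ∏ i, |A (σ i) i| := by
          rcases Int.units_eq_one_or (Equiv.Perm.sign σ) with h1 | h1 <;>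
            simp [h1, Finset.abs_prod]
        rw [this]
        exact Finset.prod_le_prod (fun _ _ => abs_nonneg _) fun i _ => h _ _
    _ = _ := by simp [Fintype.card_perm]

/-- Integer vectors in a small box that satisfy a common linear congruence mod `p` satisfy a
common linear equation over `ℤ` with bounded coefficients. -/
theorem exists_int_relation_of_small {e p : ℕ} [Fact p.Prime] {a : Fin e → ZMod p} (ha : a ≠ 0)
    {B : Fin e → ℤ} {M : ℤ} (hM : 1 ≤ M) (hBM : ∀ i, B i ≤ M)
    (hB : e.factorial * ∏ i, B i < p) {U : Set (Fin e → ℤ)}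
    (hU : ∀ u ∈ U, ∀ i, |u i| ≤ B i) (hUa : ∀ u ∈ U, ∑ i, a i * (u i : ZMod p) = 0) :
    ∃ b : Fin e → ℤ, b ≠ 0 ∧ (∀ i, |b i| ≤ e * (e.factorial * M ^ e)) ∧
      ∀ u ∈ U, ∑ i, b i * u i = 0 := by
  classical
  -- `P k`: some `k` vectors of `U` have a nonzero `k × k` minor on the columns chosen by `c`. The
  -- relation is built from a minor of maximal size.
  let P : ℕ → Prop := fun k => ∃ (v : Fin k → Fin e → ℤ) (c : Fin k → Fin e),
    (∀ l, v l ∈ U) ∧ (Matrix.of fun l i => v l (c i)).det ≠ 0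
  have h0 : P 0 := ⟨Fin.elim0, Fin.elim0, fun l => l.elim0, by simp⟩
  have inj_of : ∀ {k : ℕ} (v : Fin k → Fin e → ℤ) (c : Fin k → Fin e),
      (Matrix.of fun l i => v l (c i)).det ≠ 0 → Function.Injective c := by
    intro k v c hdet i j hij
    by_contra hne
    exact hdet (Matrix.det_zero_of_column_eq hne fun l => by simp [hij])
  -- A full-size minor is divisible by `p`, since `a` is a nonzero kernel vector mod `p`, and is
  -- smaller than `p` by the Leibniz bound; hence it is zero.
  have he : ¬ P e := by
    rintro ⟨v, c, hv, hdet⟩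
    have hc := Finite.injective_iff_bijective.mp (inj_of v c hdet)
    let σ := Equiv.ofBijective c hc
    have hlt : |(Matrix.of fun l i => v l (c i)).det| < p := by
      refine lt_of_le_of_lt (abs_det_le_factorial_mul_prod _ (fun i => B (c i))
        fun l i => hU _ (hv l) _) ?_
      rwa [show ∏ i, B (c i) = ∏ i, B i from Equiv.prod_comp σ B]
    refine hdet (Int.eq_zero_of_abs_lt_dvd ?_ hlt)
    rw [← ZMod.intCast_zmod_eq_zero_iff_dvd]
    have : ((Int.castRingHom (ZMod p)).mapMatrix (Matrix.of fun l i => v l (c i))).det = 0 := by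
      rw [← Matrix.exists_mulVec_eq_zero_iff]
      refine ⟨fun i => a (c i), fun h => ha ?_, ?_⟩
      · funext i
        obtain ⟨j, rfl⟩ := hc.2 i
        exact congrFun h j
      · funext l
        have := hUa _ (hv l)
        rw [← Equiv.sum_comp σ] at this
        simpa [Matrix.mulVec, dotProduct, σ, mul_comm] using this
    rw [← RingHom.map_det] at this
    simpa using this
  obtain ⟨k, hke, hk, hk1⟩ : ∃ k, k < e ∧ P k ∧ ¬ P (k + 1) := by
    by_contra! hcon
    have : ∀ k, k ≤ e → P k := by
      intro k
      induction k with
      | zero => exact fun _ => h0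
      | succ k ih => exact fun hk => hcon k (by omega) (ih (by omega))
    exact he (this e le_rfl)
  obtain ⟨v, c, hv, hdet⟩ := hk
  obtain ⟨j, hj⟩ : ∃ j, j ∉ Set.range c := by
    by_contra! hcon
    have := Fintype.card_le_of_surjective c hcon
    simp at this
    omega
  -- Border the maximal minor by a new column `j` and a free row. The cofactors of that row are the
  -- coefficients sought; the one at `j` is the maximal minor itself, so they do not all vanish.
  let c' : Fin (k + 1) → Fin e := Fin.cons j c
  let m : Fin (k + 1) → ℤ := fun l =>
    (-1) ^ (l : ℕ) * (Matrix.of fun (s i : Fin k) => v s (c' (l.succAbove i))).det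
  refine ⟨fun i => ∑ l, if c' l = i then m l else 0, fun h => hdet ?_, fun i => ?_, fun u hu => ?_⟩
  · have := congrFun h j
    rw [Fin.sum_univ_succ] at this
    have h2 : ∀ l : Fin k, c l ≠ j := fun l hl => hj ⟨l, hl⟩
    simpa [c', m, h2] using this
  · have hm : ∀ l, |m l| ≤ e.factorial * M ^ e := by
      intro l
      simp only [m, abs_mul, abs_pow, abs_neg, abs_one, one_pow, one_mul]
      refine (abs_det_le_factorial_mul_prod _ (fun _ => M)
        fun s i => (hU _ (hv s) _).trans (hBM _)).trans ?_
      simp only [Finset.prod_const, Finset.card_univ, Fintype.card_fin]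
      gcongr
    calc |∑ l, if c' l = i then m l else 0| ≤ ∑ l, |if c' l = i then m l else 0| :=
          Finset.abs_sum_le_sum_abs _ _
      _ ≤ ∑ _l : Fin (k + 1), (e.factorial * M ^ e : ℤ) := by
          refine Finset.sum_le_sum fun l _ => ?_
          split_ifs
          · exact hm l
          · simp; positivity
      _ = ((k + 1 : ℕ) : ℤ) * (e.factorial * M ^ e) := by simp
      _ ≤ _ := by gcongr; omega
  -- With `u` as the free row, the bordered determinant vanishes by maximality of `k`; its expansion
  -- along that row is the relation.
  · have hz : (Matrix.of fun l i => (Fin.cons u v : Fin (k + 1) → Fin e → ℤ) l (c' i)).det = 0 := by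
      by_contra hne
      refine hk1 ⟨Fin.cons u v, c', fun l => ?_, hne⟩
      refine Fin.cases ?_ (fun l => ?_) l
      · simpa using hu
      · simpa using hv l
    rw [Matrix.det_succ_row_zero] at hz
    refine Eq.trans ?_ hz
    simp_rw [Finset.sum_mul]
    rw [Finset.sum_comm]
    refine Finset.sum_congr rfl fun l _ => ?_
    simp only [ite_mul, zero_mul, Finset.sum_ite_eq, Finset.mem_univ, if_true]
    simp only [m, Matrix.of_apply, Fin.cons_zero]
    have : ((Matrix.of fun l i => (Fin.cons u v : Fin (k + 1) → Fin e → ℤ) l (c' i)).submatrix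
        Fin.succ l.succAbove) = Matrix.of fun (s i : Fin k) => v s (c' (l.succAbove i)) := by
      ext s i
      simp
    rw [this]
    ring

/-! ### Additive energy of polynomials over the integers and mod `p`. -/

/-- The quadruples `((x, y), (z, w))` of members of `A` with `g x + g y = g z + g w`. -/
def energyQuads {R : Type*} [Add R] [DecidableEq R] (A : Finset ℤ) (g : ℤ → R) :
    Finset ((ℤ × ℤ) × (ℤ × ℤ)) :=
  ((A ×ˢ A) ×ˢ (A ×ˢ A)).filter fun q => g q.1.1 + g q.1.2 = g q.2.1 + g q.2.2

theorem mem_energyQuads {R : Type*} [Add R] [DecidableEq R] {A : Finset ℤ} {g : ℤ → R}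
    {q : (ℤ × ℤ) × (ℤ × ℤ)} :
    q ∈ energyQuads A g ↔ ((q.1.1 ∈ A ∧ q.1.2 ∈ A) ∧ q.2.1 ∈ A ∧ q.2.2 ∈ A) ∧
      g q.1.1 + g q.1.2 = g q.2.1 + g q.2.2 := by
  simp [energyQuads, and_assoc]

theorem card_pairs_eval_eq_le {R : Type*} [CommRing R] [IsDomain R] [DecidableEq R]
    {P : R[X]} (hP : 1 ≤ P.natDegree) (A : Finset ℤ) (hA : Set.InjOn (fun x : ℤ => (x : R)) A) :
    ((A ×ˢ A).filter fun z => P.eval (z.1 : R) = P.eval (z.2 : R)).card ≤ P.natDegree * A.card := by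
  refine (Finset.card_le_mul_card_image_of_maps_to (f := Prod.snd) (t := A)
    (fun z hz => (Finset.mem_product.1 (Finset.mem_filter.1 hz).1).2) P.natDegree
    fun y _ => ?_)
  refine le_trans ?_ (card_filter_eval_eq_le hP A hA (P.eval (y : R)))
  refine Finset.card_le_card_of_injOn Prod.fst (fun z hz => ?_) (fun z hz z' hz' h => ?_)
  · simp only [Finset.coe_filter, Finset.mem_filter, Finset.mem_product, Set.mem_ofPred_eq] at hz ⊢
    exact ⟨hz.1.1.1, by rw [← hz.2]; exact hz.1.2⟩
  · simp only [Finset.coe_filter, Finset.mem_filter, Set.mem_ofPred_eq] at hz hz'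
    exact Prod.ext h (hz.2.trans hz'.2.symm)

theorem card_pairs_sub_eq_le {R : Type*} [CommRing R] [IsDomain R] [DecidableEq R]
    {P : R[X]} (hP : 2 ≤ P.natDegree) (A : Finset ℤ) (hA : Set.InjOn (fun x : ℤ => (x : R)) A)
    {δ : ℤ} (hδ : (P.natDegree : R) * δ ≠ 0) (c : R) :
    ((A ×ˢ A).filter fun z => z.1 - z.2 = δ ∧ P.eval (z.1 : R) - P.eval (z.2 : R) = c).card
      ≤ P.natDegree := by
  refine le_trans ?_ (card_filter_eval_add_sub_eval_le hP hδ A hA c)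
  refine Finset.card_le_card_of_injOn Prod.snd (fun z hz => ?_) (fun z hz z' hz' h => ?_)
  · simp only [Finset.coe_filter, Finset.mem_product, Set.mem_ofPred_eq] at hz ⊢
    refine ⟨hz.1.2, ?_⟩
    rw [← hz.2.2, ← hz.2.1]
    push_cast
    simp
  · simp only [Finset.coe_filter, Set.mem_ofPred_eq] at hz hz'
    refine Prod.ext ?_ h
    have := hz.2.1
    have := hz'.2.1
    rw [h] at *
    omega

/-- Quadruples that solve a polynomial equation mod `p` and have `x + y = z + w`. -/
theorem card_energyQuads_filter_add_eq_le {R : Type*} [CommRing R] [IsDomain R] [DecidableEq R]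
    {P : R[X]} (hP : 2 ≤ P.natDegree) (A : Finset ℤ) (hA : Set.InjOn (fun x : ℤ => (x : R)) A)
    (hA' : ∀ x ∈ A, ∀ y ∈ A, x ≠ y → (P.natDegree : R) * (x - y : ℤ) ≠ 0) :
    ((energyQuads A fun x => P.eval (x : R)).filter
      fun q => q.1.1 + q.1.2 = q.2.1 + q.2.2).card ≤ (P.natDegree + 1) * A.card ^ 2 := by
  classical
  set Q := (energyQuads A fun x => P.eval (x : R)).filter
      fun q => q.1.1 + q.1.2 = q.2.1 + q.2.2 with hQ
  -- Quadruples with `x = z` also have `y = w`. In the others, `x` and `z` fix the nonzero step `x -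
  -- z = w - y` and the value of a finite difference, leaving at most `deg P` pairs `(w, y)`.
  rw [← Finset.card_filter_add_card_filter_not (s := Q) (fun q => q.1.1 = q.2.1), add_comm,
    add_mul, one_mul]
  refine add_le_add ?_ ?_
  · refine (Finset.card_le_mul_card_image_of_maps_to (f := fun q => (q.1.1, q.2.1)) (t := A ×ˢ A)
      (fun q hq => ?_) P.natDegree fun y hy => ?_).trans (by simp [sq])
    · simp only [hQ, Finset.mem_filter, mem_energyQuads] at hq
      simp [hq.1.1.1]
    · by_cases hy' : y.1 = y.2
      · rw [Finset.card_eq_zero.2]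
        · exact Nat.zero_le _
        · refine Finset.filter_eq_empty_iff.2 fun q hq hqy => ?_
          subst hqy
          exact (Finset.mem_filter.1 hq).2 hy'
      rw [Finset.mem_product] at hy
      refine le_trans ?_ (card_pairs_sub_eq_le hP A hA (hA' _ hy.1 _ hy.2 hy')
        (P.eval (y.1 : R) - P.eval (y.2 : R)))
      refine Finset.card_le_card_of_injOn (fun q => (q.2.2, q.1.2)) (fun q hq => ?_)
        (fun q hq q' hq' h => ?_)
      · simp only [hQ, Finset.coe_filter, Finset.mem_filter, mem_energyQuads, Set.mem_ofPred_eq,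
          Finset.mem_product] at hq ⊢
        obtain ⟨⟨⟨⟨h1, h2⟩, h3⟩, -⟩, rfl⟩ := hq
        exact ⟨⟨h1.2.2, h1.1.2⟩, by simp only; omega, by simp only; linear_combination -h2⟩
      · simp only [Finset.coe_filter, Set.mem_ofPred_eq] at hq hq'
        have h1 := hq.2.trans hq'.2.symm
        simp only [Prod.mk.injEq] at h h1
        exact Prod.ext (Prod.ext h1.1 h.2) (Prod.ext h1.2 h.1)
  · have : A.card ^ 2 = (A ×ˢ A).card := by simp [sq]
    rw [this]
    refine Finset.card_le_card_of_injOn Prod.fst (fun q hq => ?_) (fun q hq q' hq' h => ?_)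
    · simp only [hQ, Finset.coe_filter, Finset.mem_filter, mem_energyQuads, Set.mem_ofPred_eq] at hq
      simp [hq.1.1.1]
    · simp only [hQ, Finset.coe_filter, Finset.mem_filter, mem_energyQuads, Set.mem_ofPred_eq]
        at hq hq'
      obtain ⟨⟨-, h1⟩, h2⟩ := hq
      obtain ⟨⟨-, h1'⟩, h2'⟩ := hq'
      rw [Prod.ext_iff] at h
      refine Prod.ext (Prod.ext h.1 h.2) (Prod.ext ?_ ?_) <;> omega

/-- The additive energy of an integer polynomial of degree at least two on a set of integers is
controlled by the divisor function. -/
theorem card_energyQuads_int_le {g : ℤ[X]} (hg : 2 ≤ g.natDegree) (A : Finset ℤ) {D : ℕ}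
    (hD : ∀ x ∈ A, ∀ y ∈ A, g.eval x ≠ g.eval y →
      (g.eval x - g.eval y).natAbs.divisors.card ≤ D) :
    (energyQuads A fun x => g.eval x).card ≤
      (2 * g.natDegree * D + g.natDegree ^ 2) * A.card ^ 2 := by
  classical
  have hA : Set.InjOn (fun x : ℤ => ((x : ℤ) : ℤ)) A := fun x _ y _ h => by simpa using h
  set Q := energyQuads A fun x => g.eval x with hQ
  rw [← Finset.card_filter_add_card_filter_not (s := Q) (fun q => g.eval q.1.1 = g.eval q.2.1),
    add_comm, add_mul]
  refine add_le_add ?_ ?_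
  · refine (Finset.card_le_mul_card_image_of_maps_to (f := fun q => (q.2.2, q.1.2)) (t := A ×ˢ A)
      (fun q hq => ?_) (2 * g.natDegree * D) fun y hy => ?_).trans (by simp [sq])
    · simp only [hQ, Finset.mem_filter, mem_energyQuads] at hq
      simp [hq.1.1]
    -- With `w` and `y` fixed, `x - z` is a signed divisor of `N = g w - g y = g x - g z ≠ 0`; once
    -- it is chosen, a finite difference leaves at most `deg g` pairs.
    · set N := g.eval y.1 - g.eval y.2 with hN
      by_cases hy' : g.eval y.1 = g.eval y.2
      · rw [Finset.card_eq_zero.2]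
        · exact Nat.zero_le _
        · refine Finset.filter_eq_empty_iff.2 fun q hq hqy => ?_
          subst hqy
          simp only [hQ, Finset.mem_filter, mem_energyQuads] at hq
          simp only at hy'
          omega
      rw [Finset.mem_product] at hy
      have hN0 : N ≠ 0 := sub_ne_zero.2 hy'
      set F := (Q.filter fun q => ¬ g.eval q.1.1 = g.eval q.2.1).filter
        fun q => (q.2.2, q.1.2) = y with hF
      let T : Finset ℤ := N.natAbs.divisors.image (fun d : ℕ => (d : ℤ)) ∪
        N.natAbs.divisors.image (fun d : ℕ => -(d : ℤ))
      have hT : T.card ≤ 2 * D := by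
        have : N.natAbs.divisors.card ≤ D := hD _ hy.1 _ hy.2 hy'
        refine (Finset.card_union_le _ _).trans ?_
        have h1 : (N.natAbs.divisors.image (fun d : ℕ => (d : ℤ))).card ≤ _ :=
          Finset.card_image_le
        have h2 : (N.natAbs.divisors.image (fun d : ℕ => -(d : ℤ))).card ≤ _ :=
          Finset.card_image_le
        omega
      have hFmem : ∀ q ∈ F, (q.1.1 ∈ A ∧ q.2.1 ∈ A) ∧ g.eval q.1.1 - g.eval q.2.1 = N ∧
          q.2.2 = y.1 ∧ q.1.2 = y.2 := by
        intro q hq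
        simp only [hF, hQ, Finset.mem_filter, mem_energyQuads] at hq
        obtain ⟨⟨⟨h1, h2⟩, -⟩, h4⟩ := hq
        rw [Prod.ext_iff] at h4
        simp only at h4
        refine ⟨⟨h1.1.1, h1.2.1⟩, ?_, h4⟩
        rw [hN, ← h4.1, ← h4.2]
        linear_combination h2
      refine (Finset.card_le_mul_card_image_of_maps_to (f := fun q => q.1.1 - q.2.1) (t := T)
        (fun q hq => ?_) g.natDegree fun δ hδ => ?_).trans ?_
      · obtain ⟨-, h2, -⟩ := hFmem q hq
        have hdvd : q.1.1 - q.2.1 ∣ N := h2 ▸ sub_dvd_eval_sub _ _ _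
        simp only [T, Finset.mem_union, Finset.mem_image, Nat.mem_divisors]
        rcases Int.natAbs_eq (q.1.1 - q.2.1) with h | h
        · exact Or.inl ⟨_, ⟨Int.natAbs_dvd_natAbs.2 hdvd, by simpa⟩, h.symm⟩
        · exact Or.inr ⟨_, ⟨Int.natAbs_dvd_natAbs.2 hdvd, by simpa⟩, h.symm⟩
      · have hδ0 : δ ≠ 0 := by
          rintro rfl
          simp [T] at hδ
        refine le_trans ?_ (card_pairs_sub_eq_le hg A hA
          (mul_ne_zero (by simp; omega) (by simpa using hδ0)) N)
        refine Finset.card_le_card_of_injOn (fun q => (q.1.1, q.2.1)) (fun q hq => ?_)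
          (fun q hq q' hq' h => ?_)
        · obtain ⟨hq1, hq2⟩ := Finset.mem_filter.1 hq
          obtain ⟨h1, h2, -⟩ := hFmem q hq1
          simp only [Finset.coe_filter, Set.mem_ofPred_eq, Finset.mem_product]
          exact ⟨h1, hq2, by simpa using h2⟩
        · obtain ⟨hq1, -⟩ := Finset.mem_filter.1 hq
          obtain ⟨hq1', -⟩ := Finset.mem_filter.1 hq'
          obtain ⟨-, -, h3, h4⟩ := hFmem q hq1
          obtain ⟨-, -, h3', h4'⟩ := hFmem q' hq1'
          rw [Prod.mk.injEq] at h
          exact Prod.ext (Prod.ext h.1 (h4.trans h4'.symm)) (Prod.ext h.2 (h3.trans h3'.symm))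
      · calc _ ≤ g.natDegree * (2 * D) := by gcongr
          _ = _ := by ring
  -- If `g x = g z`, then also `g y = g w`, so these quadruples are pairs of coincidences.
  · have h1 := card_pairs_eval_eq_le (P := g) (by omega) A hA
    set Z := (A ×ˢ A).filter fun z => g.eval ((z.1 : ℤ) : ℤ) = g.eval ((z.2 : ℤ) : ℤ) with hZ
    have h2 : Z.card ^ 2 ≤ g.natDegree ^ 2 * A.card ^ 2 := by
      rw [← mul_pow]
      exact Nat.pow_le_pow_left h1 2
    refine le_trans ?_ h2
    rw [sq, ← Finset.card_product]
    refine Finset.card_le_card_of_injOn (fun q => ((q.1.1, q.2.1), (q.1.2, q.2.2)))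
      (fun q hq => ?_) (fun q _ q' _ h => ?_)
    · simp only [hQ, Finset.coe_filter, mem_energyQuads, Set.mem_ofPred_eq] at hq
      simp only [hZ, Finset.coe_product, Finset.coe_filter, Set.mem_prod, Set.mem_ofPred_eq,
        Finset.mem_product]
      obtain ⟨⟨h3, h4⟩, h5⟩ := hq
      exact ⟨⟨⟨h3.1.1, h3.2.1⟩, h5⟩, ⟨h3.1.2, h3.2.2⟩, by omega⟩
    · simp only [Prod.mk.injEq] at h
      exact Prod.ext (Prod.ext h.1.1 h.2.1) (Prod.ext h.1.2 h.2.2)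

/-- The additive energy modulo `p` of a polynomial on a short interval. -/
theorem card_energyQuads_zmod_le {e p L D : ℕ} [Fact p.Prime] (hep : e < p) (hLp : L < p)
    (hL : (e.factorial * ∏ i : Fin e, (2 * L ^ ((i : ℕ) + 1)) : ℕ) < p)
    (hD : ∀ N : ℕ, N ≠ 0 → N ≤ 2 * e ^ 2 * e.factorial * 2 ^ e * (L + 1) ^ (e ^ 2 + e) →
      N.divisors.card ≤ D)
    {f : (ZMod p)[X]} (hf : 2 ≤ f.natDegree) (hfe : f.natDegree ≤ e) :
    (energyQuads (Finset.Icc 0 (L : ℤ)) fun x => f.eval (x : ZMod p)).card ≤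
      (2 * e * D + e ^ 2 + e + 1) * (L + 1) ^ 2 := by
  classical
  set A := Finset.Icc 0 (L : ℤ) with hAdef
  have hAcard : A.card = L + 1 := by simp [A]
  have hne : ∀ x ∈ A, ∀ y ∈ A, x ≠ y → ((x - y : ℤ) : ZMod p) ≠ 0 := by
    intro x hx y hy hxy h0
    rw [ZMod.intCast_zmod_eq_zero_iff_dvd] at h0
    simp only [A, Finset.mem_Icc] at hx hy
    have := Int.eq_zero_of_abs_lt_dvd h0 (by rw [abs_lt]; constructor <;> omega)
    omega
  have hA : Set.InjOn (fun x : ℤ => (x : ZMod p)) A := by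
    intro x hx y hy h
    by_contra hxy
    refine hne x hx y hy hxy ?_
    push_cast
    exact sub_eq_zero.2 h
  have hA' : ∀ x ∈ A, ∀ y ∈ A, x ≠ y → (f.natDegree : ZMod p) * (x - y : ℤ) ≠ 0 := by
    intro x hx y hy hxy
    refine mul_ne_zero (fun h => ?_) (hne x hx y hy hxy)
    rw [ZMod.natCast_eq_zero_iff] at h
    have := Nat.le_of_dvd (by omega) h
    omega
  set Q := energyQuads A fun x => f.eval (x : ZMod p) with hQ
  let u : (ℤ × ℤ) × (ℤ × ℤ) → Fin e → ℤ := fun q i =>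
    q.1.1 ^ ((i : ℕ) + 1) + q.1.2 ^ ((i : ℕ) + 1) - q.2.1 ^ ((i : ℕ) + 1) - q.2.2 ^ ((i : ℕ) + 1)
  -- The constant term is omitted: it cancels in the equation.
  let a : Fin e → ZMod p := fun i => f.coeff (i + 1)
  have ha : a ≠ 0 := by
    intro h
    have h1 := congrFun h ⟨f.natDegree - 1, by omega⟩
    simp only [a, Pi.zero_apply, show f.natDegree - 1 + 1 = f.natDegree by omega] at h1
    have h2 : f = 0 := leadingCoeff_eq_zero.1 h1
    simp [h2] at hf
  obtain ⟨b, hb0, hbM, hbu⟩ := exists_int_relation_of_small (M := 2 * (L + 1) ^ e)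
      (B := fun i => 2 * (L : ℤ) ^ ((i : ℕ) + 1)) (U := u '' Q) ha
      (by have : (1 : ℤ) ≤ (L + 1) ^ e := one_le_pow₀ (by omega)
          omega)
      (fun i => by
        have h1 : (L : ℤ) ^ ((i : ℕ) + 1) ≤ (L + 1) ^ ((i : ℕ) + 1) := by gcongr; omega
        have h2 : ((L : ℤ) + 1) ^ ((i : ℕ) + 1) ≤ (L + 1) ^ e :=
          pow_le_pow_right₀ (by omega) (by omega)
        omega)
      (by exact_mod_cast hL)
      (by
        rintro _ ⟨q, hq, rfl⟩ i
        have hq' := (mem_energyQuads.1 hq).1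
        have hpow : ∀ x ∈ A, 0 ≤ x ^ ((i : ℕ) + 1) ∧ x ^ ((i : ℕ) + 1) ≤ (L : ℤ) ^ ((i : ℕ) + 1) := by
          intro x hx
          rw [Finset.mem_Icc] at hx
          exact ⟨pow_nonneg hx.1 _, pow_le_pow_left₀ hx.1 hx.2 _⟩
        have h1 := hpow _ hq'.1.1
        have h2 := hpow _ hq'.1.2
        have h3 := hpow _ hq'.2.1
        have h4 := hpow _ hq'.2.2
        rw [abs_le]
        simp only [u]
        constructor <;> linarith)
      (by
        rintro _ ⟨q, hq, rfl⟩
        have hq' := (mem_energyQuads.1 hq).2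
        have hev : ∀ x : ℤ, f.eval (x : ZMod p) =
            ∑ i : Fin e, a i * (x : ZMod p) ^ ((i : ℕ) + 1) + f.coeff 0 := by
          intro x
          rw [eval_eq_sum_range' (n := e + 1) (by omega), Finset.sum_range_succ',
            Fin.sum_univ_eq_sum_range (fun i => f.coeff (i + 1) * (x : ZMod p) ^ (i + 1))]
          simp
        simp only [hev] at hq'
        simp only [u]
        push_cast
        simp only [mul_add, mul_sub, Finset.sum_add_distrib, Finset.sum_sub_distrib]
        linear_combination hq')
  set g : ℤ[X] := ∑ i : Fin e, C (b i) * X ^ ((i : ℕ) + 1) with hg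
  have hgdeg : g.natDegree ≤ e := natDegree_sum_le_of_forall_le _ _ fun i _ =>
    (natDegree_C_mul_X_pow_le _ _).trans (by omega)
  have hgeval : ∀ x : ℤ, g.eval x = ∑ i : Fin e, b i * x ^ ((i : ℕ) + 1) := by
    intro x
    simp [hg, eval_finsetSum]
  have hgcoeff : ∀ i : Fin e, g.coeff ((i : ℕ) + 1) = b i := by
    intro i
    simp [hg, coeff_X_pow, Fin.val_inj]
  have hgQ : ∀ q ∈ Q, g.eval q.1.1 + g.eval q.1.2 = g.eval q.2.1 + g.eval q.2.2 := by
    intro q hq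
    have := hbu _ ⟨q, hq, rfl⟩
    simp only [u, mul_add, mul_sub, Finset.sum_add_distrib, Finset.sum_sub_distrib] at this
    simp only [hgeval]
    linarith
  have hg1 : 1 ≤ g.natDegree := by
    obtain ⟨i, hi⟩ := Function.ne_iff.1 hb0
    exact (Nat.le_add_left 1 (i : ℕ)).trans (le_natDegree_of_ne_zero (by rw [hgcoeff i]; exact hi))
  -- The divisor argument needs `deg g ≥ 2`. A linear `g` instead forces `x + y = z + w`, and the
  -- nonlinearity of `f` itself gives the bound.
  rcases hg1.eq_or_lt with hg1 | hg2
  · have hg1' := natDegree_eq_one.1 hg1.symm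
    obtain ⟨c, hc, c', hcc⟩ := hg1'
    have hsub : Q ⊆ Q.filter fun q => q.1.1 + q.1.2 = q.2.1 + q.2.2 := by
      intro q hq
      refine Finset.mem_filter.2 ⟨hq, ?_⟩
      have := hgQ q hq
      simp only [← hcc, eval_add, eval_mul, eval_C, eval_X] at this
      exact mul_left_cancel₀ hc (by linarith)
    calc Q.card ≤ _ := Finset.card_le_card hsub
      _ ≤ (f.natDegree + 1) * A.card ^ 2 := card_energyQuads_filter_add_eq_le hf A hA hA'
      _ ≤ _ := by rw [hAcard]; gcongr; omega
  · have hsub : Q ⊆ energyQuads A fun x => g.eval x := fun q hq =>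
      mem_energyQuads.2 ⟨(mem_energyQuads.1 hq).1, hgQ q hq⟩
    -- Twice this bound is the range in which `hD` controls the number of divisors of `g x - g y`.
    have hgabs : ∀ x ∈ A, |g.eval x| ≤
        e ^ 2 * e.factorial * 2 ^ e * ((L : ℤ) + 1) ^ (e ^ 2 + e) := by
      intro x hx
      rw [Finset.mem_Icc] at hx
      rw [hgeval]
      calc |∑ i : Fin e, b i * x ^ ((i : ℕ) + 1)| ≤ ∑ i : Fin e, |b i * x ^ ((i : ℕ) + 1)| :=
            Finset.abs_sum_le_sum_abs _ _
        _ ≤ ∑ _i : Fin e, (e * (e.factorial * (2 * (L + 1) ^ e) ^ e) * (L + 1) ^ e : ℤ) := by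
            refine Finset.sum_le_sum fun i _ => ?_
            rw [abs_mul, abs_of_nonneg (pow_nonneg hx.1 _)]
            refine mul_le_mul (hbM i) ?_ (pow_nonneg hx.1 _) (by positivity)
            calc x ^ ((i : ℕ) + 1) ≤ ((L : ℤ) + 1) ^ ((i : ℕ) + 1) :=
                  pow_le_pow_left₀ hx.1 (by omega) _
              _ ≤ _ := pow_le_pow_right₀ (by omega) (by omega)
        _ = _ := by
            simp only [Finset.sum_const, Finset.card_univ, Fintype.card_fin, nsmul_eq_mul]
            ring
    have := card_energyQuads_int_le hg2 A (D := D) fun x hx y hy hxy => hD _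
      (by simpa using sub_ne_zero.2 hxy) (by
        have h1 := hgabs x hx
        have h2 := hgabs y hy
        zify
        have h3 := abs_sub (g.eval x) (g.eval y)
        linarith)
    calc Q.card ≤ _ := Finset.card_le_card hsub
      _ ≤ _ := this
      _ ≤ (2 * e * D + e ^ 2) * (L + 1) ^ 2 := by rw [hAcard]; gcongr
      _ ≤ _ := Nat.mul_le_mul_right _ (by omega)

/-! ### Cauchy–Schwarz and additive equations with distinct terms. -/

theorem card_filter_eq_eq_sum {α β F : Type*} [Fintype F] [DecidableEq F]
    (s : Finset α) (t : Finset β) (φ : α → F) (ψ : β → F) :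
    ((s ×ˢ t).filter fun z => φ z.1 = ψ z.2).card =
      ∑ c : F, (s.filter fun a => φ a = c).card * (t.filter fun b => ψ b = c).card := by
  rw [Finset.card_eq_sum_card_fiberwise (f := fun z => φ z.1) (t := Finset.univ)
    (fun _ _ => Finset.mem_coe.2 (Finset.mem_univ _))]
  refine Finset.sum_congr rfl fun c _ => ?_
  rw [← Finset.card_product]
  congr 1
  ext z
  simp only [Finset.mem_filter, Finset.mem_product]
  constructor
  · rintro ⟨⟨⟨h1, h2⟩, h3⟩, h4⟩
    exact ⟨⟨h1, h4⟩, h2, by rw [← h3, h4]⟩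
  · rintro ⟨⟨h1, h2⟩, h3, h4⟩
    exact ⟨⟨⟨h1, h3⟩, by rw [h2, h4]⟩, h2⟩

/-- Cauchy–Schwarz for the number of coincidences `φ a = ψ b`. -/
theorem sq_card_filter_eq_le {α β F : Type*} [Fintype F] [DecidableEq F]
    (s : Finset α) (t : Finset β) (φ : α → F) (ψ : β → F) :
    ((s ×ˢ t).filter fun z => φ z.1 = ψ z.2).card ^ 2 ≤
      ((s ×ˢ s).filter fun z => φ z.1 = φ z.2).card *
        ((t ×ˢ t).filter fun z => ψ z.1 = ψ z.2).card := by
  have key1 := card_filter_eq_eq_sum s t φ ψ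
  have key2 := card_filter_eq_eq_sum s s φ φ
  have key3 := card_filter_eq_eq_sum t t ψ ψ
  rw [key1, key2, key3]
  simpa only [sq] using Finset.sum_mul_sq_le_sq_mul_sq Finset.univ
    (fun c => (s.filter fun a => φ a = c).card) (fun c => (t.filter fun b => ψ b = c).card)

/-- The solutions of `g₁ x + g₂ y = g₃ z + g₄ w` in a box. -/
def quadSols {R : Type*} [Add R] [DecidableEq R] (A₁ A₂ A₃ A₄ : Finset ℤ)
    (g₁ g₂ g₃ g₄ : ℤ → R) : Finset ((ℤ × ℤ) × (ℤ × ℤ)) :=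
  ((A₁ ×ˢ A₂) ×ˢ (A₃ ×ˢ A₄)).filter fun q => g₁ q.1.1 + g₂ q.1.2 = g₃ q.2.1 + g₄ q.2.2

theorem mem_quadSols {R : Type*} [Add R] [DecidableEq R] {A₁ A₂ A₃ A₄ : Finset ℤ}
    {g₁ g₂ g₃ g₄ : ℤ → R} {q : (ℤ × ℤ) × (ℤ × ℤ)} :
    q ∈ quadSols A₁ A₂ A₃ A₄ g₁ g₂ g₃ g₄ ↔
      ((q.1.1 ∈ A₁ ∧ q.1.2 ∈ A₂) ∧ q.2.1 ∈ A₃ ∧ q.2.2 ∈ A₄) ∧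
      g₁ q.1.1 + g₂ q.1.2 = g₃ q.2.1 + g₄ q.2.2 := by
  simp [quadSols, and_assoc]

/-- Rewriting the equation as `g₁ x - g₁ z = g₂ w - g₂ y` separates the two functions, so
Cauchy–Schwarz applies; coincidences among differences of one function are its energy quadruples
rearranged. -/
theorem card_quadSols_two_le {F : Type*} [AddCommGroup F] [Fintype F] [DecidableEq F]
    {A₁ A₂ : Finset ℤ} {g₁ g₂ : ℤ → F} {B : ℕ} (h₁ : (energyQuads A₁ g₁).card ≤ B)
    (h₂ : (energyQuads A₂ g₂).card ≤ B) :
    (quadSols A₁ A₂ A₁ A₂ g₁ g₂ g₁ g₂).card ≤ B := by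
  have aux : ∀ (A : Finset ℤ) (g : ℤ → F), (((A ×ˢ A) ×ˢ (A ×ˢ A)).filter
      fun z => g z.1.1 - g z.1.2 = g z.2.1 - g z.2.2).card ≤ (energyQuads A g).card := by
    intro A g
    refine Finset.card_le_card_of_injOn (fun z => ((z.1.1, z.2.2), (z.2.1, z.1.2)))
      (fun z hz => ?_) (fun z _ z' _ h => ?_)
    · simp only [Finset.coe_filter, Finset.mem_product, Set.mem_ofPred_eq] at hz
      simp only [Finset.mem_coe, mem_energyQuads]
      exact ⟨⟨⟨hz.1.1.1, hz.1.2.2⟩, hz.1.2.1, hz.1.1.2⟩, sub_eq_sub_iff_add_eq_add.1 hz.2⟩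
    · simp only [Prod.mk.injEq] at h
      exact Prod.ext (Prod.ext h.1.1 h.2.2) (Prod.ext h.2.1 h.1.2)
  have hcs := sq_card_filter_eq_le (A₁ ×ˢ A₁) (A₂ ×ˢ A₂) (fun z => g₁ z.1 - g₁ z.2)
    (fun z => g₂ z.1 - g₂ z.2)
  have hle : (quadSols A₁ A₂ A₁ A₂ g₁ g₂ g₁ g₂).card ≤ (((A₁ ×ˢ A₁) ×ˢ (A₂ ×ˢ A₂)).filter
      fun z => g₁ z.1.1 - g₁ z.1.2 = g₂ z.2.1 - g₂ z.2.2).card := by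
    refine Finset.card_le_card_of_injOn (fun z => ((z.1.1, z.2.1), (z.2.2, z.1.2)))
      (fun z hz => ?_) (fun z _ z' _ h => ?_)
    · rw [Finset.mem_coe, mem_quadSols] at hz
      simp only [Finset.coe_filter, Finset.mem_product, Set.mem_ofPred_eq]
      refine ⟨⟨⟨hz.1.1.1, hz.1.2.1⟩, hz.1.2.2, hz.1.1.2⟩, ?_⟩
      rw [sub_eq_sub_iff_add_eq_add, hz.2]
      abel
    · simp only [Prod.mk.injEq] at h
      exact Prod.ext (Prod.ext h.1.1 h.2.2) (Prod.ext h.1.2 h.2.1)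
  refine hle.trans ((Nat.pow_le_pow_iff_left (n := 2) (by norm_num)).1 (hcs.trans ?_))
  rw [sq]
  exact Nat.mul_le_mul ((aux _ _).trans h₁) ((aux _ _).trans h₂)

/-- The number of solutions of an additive equation in four variables is bounded by the additive
energies of its terms. -/
theorem card_quadSols_le {F : Type*} [AddCommGroup F] [Fintype F] [DecidableEq F]
    {A₁ A₂ A₃ A₄ : Finset ℤ} {g₁ g₂ g₃ g₄ : ℤ → F} {B : ℕ} (h₁ : (energyQuads A₁ g₁).card ≤ B)
    (h₂ : (energyQuads A₂ g₂).card ≤ B) (h₃ : (energyQuads A₃ g₃).card ≤ B)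
    (h₄ : (energyQuads A₄ g₄).card ≤ B) :
    (quadSols A₁ A₂ A₃ A₄ g₁ g₂ g₃ g₄).card ≤ B := by
  have hcs := sq_card_filter_eq_le (A₁ ×ˢ A₂) (A₃ ×ˢ A₄) (fun z => g₁ z.1 + g₂ z.2)
    (fun z => g₃ z.1 + g₄ z.2)
  refine (Nat.pow_le_pow_iff_left (n := 2) (by norm_num)).1 (hcs.trans ?_)
  rw [sq]
  exact Nat.mul_le_mul (card_quadSols_two_le h₁ h₂) (card_quadSols_two_le h₃ h₄)

theorem card_energyQuads_shift_le {R : Type*} [Add R] [DecidableEq R] (s : ℤ) (L : ℕ)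
    (g : ℤ → R) : (energyQuads (Finset.Icc s (s + L)) g).card ≤
      (energyQuads (Finset.Icc 0 (L : ℤ)) fun x => g (x + s)).card := by
  refine Finset.card_le_card_of_injOn
    (fun z => ((z.1.1 - s, z.1.2 - s), (z.2.1 - s, z.2.2 - s))) (fun z hz => ?_)
    (fun z _ z' _ h => ?_)
  · rw [Finset.mem_coe, mem_energyQuads] at hz ⊢
    simp only [Finset.mem_Icc, sub_add_cancel] at hz ⊢
    refine ⟨?_, hz.2⟩
    omega
  · simp only [Prod.mk.injEq, sub_left_inj] at h
    exact Prod.ext (Prod.ext h.1.1 h.1.2) (Prod.ext h.2.1 h.2.2)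

/-- Splitting `[-H, H]` into `2 K + 1` intervals of length `H / K`. -/
theorem card_quadSols_Icc_le {F : Type*} [AddCommGroup F] [Fintype F] [DecidableEq F]
    {H K B : ℕ} (hK : 1 ≤ K) {g₁ g₂ g₃ g₄ : ℤ → F}
    (h : ∀ g ∈ ({g₁, g₂, g₃, g₄} : Set (ℤ → F)), ∀ s : ℤ,
      (energyQuads (Finset.Icc s (s + (H / K : ℕ))) g).card ≤ B) :
    (quadSols (Finset.Icc (-H : ℤ) H) (Finset.Icc (-H : ℤ) H) (Finset.Icc (-H : ℤ) H)
      (Finset.Icc (-H : ℤ) H) g₁ g₂ g₃ g₄).card ≤ (2 * K + 1) ^ 4 * B := by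
  set L := H / K with hL
  have hKL : H + 1 ≤ K * (L + 1) := by
    exact Nat.lt_mul_div_succ H (show 0 < K by omega)
  clear_value L
  -- Consecutive blocks of `L + 1` integers; `hKL` ensures that `2 K + 1` of them cover `[-H, H]`.
  let I : ℕ → Finset ℤ := fun j => Finset.Icc (-H + j * (L + 1) : ℤ) (-H + j * (L + 1) + L)
  let ix : ℤ → ℕ := fun x => ((x + H) / (L + 1)).toNat
  have hix : ∀ x ∈ Finset.Icc (-H : ℤ) H, ix x ∈ Finset.range (2 * K + 1) ∧ x ∈ I (ix x) := by
    intro x hx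
    rw [Finset.mem_Icc] at hx
    have h0 : 0 ≤ (x + H) / (L + 1 : ℤ) := Int.ediv_nonneg (by omega) (by omega)
    have h1 := Int.mul_ediv_add_emod (x + H) (L + 1)
    have h2 := Int.emod_nonneg (x + H) (show (L + 1 : ℤ) ≠ 0 by omega)
    have h3 := Int.emod_lt_of_pos (x + H) (show 0 < (L + 1 : ℤ) by omega)
    have h4 : ((ix x : ℕ) : ℤ) = (x + H) / (L + 1) := Int.toNat_of_nonneg h0
    constructor
    · rw [Finset.mem_range]
      zify
      rw [h4]
      refine Int.ediv_lt_of_lt_mul (by omega) ?_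
      zify at hKL
      nlinarith
    · simp only [I, Finset.mem_Icc, h4]
      constructor <;> nlinarith
  set J := Finset.range (2 * K + 1) with hJ
  have hsub : quadSols (Finset.Icc (-H : ℤ) H) (Finset.Icc (-H : ℤ) H) (Finset.Icc (-H : ℤ) H)
      (Finset.Icc (-H : ℤ) H) g₁ g₂ g₃ g₄ ⊆ ((J ×ˢ J) ×ˢ (J ×ˢ J)).biUnion fun j =>
        quadSols (I j.1.1) (I j.1.2) (I j.2.1) (I j.2.2) g₁ g₂ g₃ g₄ := by
    intro q hq
    obtain ⟨⟨⟨h1, h2⟩, h3, h4⟩, h5⟩ := mem_quadSols.1 hq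
    rw [Finset.mem_biUnion]
    refine ⟨((ix q.1.1, ix q.1.2), (ix q.2.1, ix q.2.2)), ?_, ?_⟩
    · simp only [Finset.mem_product]
      exact ⟨⟨(hix _ h1).1, (hix _ h2).1⟩, (hix _ h3).1, (hix _ h4).1⟩
    · rw [mem_quadSols]
      exact ⟨⟨⟨(hix _ h1).2, (hix _ h2).2⟩, (hix _ h3).2, (hix _ h4).2⟩, h5⟩
  refine (Finset.card_le_card hsub).trans ((Finset.card_biUnion_le_card_mul _ _ B
    fun j _ => ?_).trans (le_of_eq ?_))
  · exact card_quadSols_le (h _ (by simp) _) (h _ (by simp) _) (h _ (by simp) _) (h _ (by simp) _)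
  · simp only [hJ, Finset.card_product, Finset.card_range]
    ring

/-- The powers of `L` multiply to `L^T` with `T = e (e + 1) / 2`, and `H^T ≤ p`. Shortening the
interval by the factor `K > e! 2^e` absorbs the constant, since `K ≤ K^T`. -/
theorem factorial_mul_prod_two_mul_pow_lt {e H p : ℕ} (he : 1 ≤ e) (hp : 0 < p)
    (hHp : H ^ (e * (e + 1)) ≤ p ^ 2) :
    e.factorial * ∏ i : Fin e, (2 * (H / (e.factorial * 2 ^ e + 1)) ^ ((i : ℕ) + 1)) < p := by
  set K := e.factorial * 2 ^ e + 1 with hK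
  set L := H / K
  set T := ∑ i : Fin e, ((i : ℕ) + 1) with hTdef
  have hT2 : T * 2 = e * (e + 1) := by
    rw [hTdef, Fin.sum_univ_eq_sum_range (fun i => i + 1)]
    have := Finset.sum_range_id_mul_two (e + 1)
    rw [Finset.sum_range_succ'] at this
    simpa [mul_comm] using this
  have hT : T ≠ 0 := by
    intro h
    rw [h] at hT2
    nlinarith
  have hprod : ∏ i : Fin e, (2 * L ^ ((i : ℕ) + 1)) = 2 ^ e * L ^ T := by
    rw [Finset.prod_mul_distrib, Finset.prod_pow_eq_pow_sum, ← hTdef]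
    simp
  rw [hprod, ← mul_assoc]
  rcases Nat.eq_zero_or_pos L with hL | hL
  · rw [hL, zero_pow hT]
    simpa using hp
  · have hHT : H ^ T ≤ p := by
      refine (Nat.pow_le_pow_iff_left (n := 2) (by norm_num)).1 ?_
      rwa [← pow_mul, hT2]
    calc e.factorial * 2 ^ e * L ^ T < K * L ^ T := by
          have : 0 < L ^ T := by positivity
          exact Nat.mul_lt_mul_of_pos_right (by omega) this
      _ ≤ K ^ T * L ^ T := by
          gcongr
          exact Nat.le_self_pow hT K
      _ = (K * L) ^ T := (mul_pow _ _ _).symm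
      _ ≤ H ^ T := Nat.pow_le_pow_left (Nat.mul_div_le H K) T
      _ ≤ p := hHT

/-- The number of solutions in `[-H, H]` of an additive equation in four variables modulo `p`
whose terms are polynomials of degree between `2` and `e`, when `H ≤ p ^ (2 / (e (e + 1)))`. -/
theorem exists_card_quadSols_le {e : ℕ} (he : 2 ≤ e) {ε : ℝ} (hε : 0 < ε) :
    ∃ C : ℝ, 1 ≤ C ∧ ∀ H p : ℕ, e ≤ H → Fact p.Prime → H ^ (e * (e + 1)) ≤ p ^ 2 →
      ∀ f₁ f₂ f₃ f₄ : (ZMod p)[X],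
      (∀ f ∈ ({f₁, f₂, f₃, f₄} : Set (ZMod p)[X]), 2 ≤ f.natDegree ∧ f.natDegree ≤ e) →
      ((quadSols (Finset.Icc (-H : ℤ) H) (Finset.Icc (-H : ℤ) H) (Finset.Icc (-H : ℤ) H)
        (Finset.Icc (-H : ℤ) H) (fun x => f₁.eval (x : ZMod p)) (fun x => f₂.eval (x : ZMod p))
        (fun x => f₃.eval (x : ZMod p)) (fun x => f₄.eval (x : ZMod p))).card : ℝ) ≤
        C * (H : ℝ) ^ (2 + ε) := by
  set k : ℕ := e ^ 2 + e with hk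
  have hk0 : (0 : ℝ) < k := by positivity
  -- The integers to be factored are `O(H^k)`, so the divisor bound is taken with exponent `ε / k`.
  obtain ⟨C₀, hC₀, hdiv⟩ := exists_card_divisors_le_rpow (ε := ε / k) (by positivity)
  set c₁ : ℝ := 2 * e ^ 2 * e.factorial * 2 ^ e * 2 ^ k with hc₁
  set c₂ : ℝ := C₀ * c₁ ^ (ε / k) with hc₂
  have hc₂0 : 0 ≤ c₂ := by positivity
  set K := e.factorial * 2 ^ e + 1 with hK
  refine ⟨(2 * K + 1) ^ 4 * ((2 * e * c₂ + e ^ 2 + e + 1) * 4), ?_,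
    fun H p heH hp hHp f₁ f₂ f₃ f₄ hf => ?_⟩
  · have h1 : (1 : ℝ) ≤ (2 * K + 1) ^ 4 := one_le_pow₀ (by
      have : (0 : ℝ) ≤ K := by positivity
      linarith)
    have h2 : (0 : ℝ) ≤ 2 * e * c₂ + e ^ 2 + e := by positivity
    nlinarith
  have hH1 : (1 : ℝ) ≤ H := by exact_mod_cast (show 1 ≤ H by omega)
  -- Together with `e ≤ H` this gives `e < p`, so the degrees are invertible mod `p`, as finite
  -- differences require.
  have hHlt : H < p := by
    have h1 : H ^ 2 < H ^ (e * (e + 1)) := Nat.pow_lt_pow_right (by omega) (by nlinarith)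
    exact (Nat.pow_lt_pow_iff_left (n := 2) (by norm_num)).1 (h1.trans_le hHp)
  set L := H / K with hL
  have hLH : L ≤ H := Nat.div_le_self _ _
  set D := ⌊c₂ * (H : ℝ) ^ ε⌋₊ with hDdef
  have hDle : (D : ℝ) ≤ c₂ * (H : ℝ) ^ ε := Nat.floor_le (by positivity)
  have hD : ∀ N : ℕ, N ≠ 0 → N ≤ 2 * e ^ 2 * e.factorial * 2 ^ e * (L + 1) ^ (e ^ 2 + e) →
      N.divisors.card ≤ D := by
    intro N hN hNle
    refine Nat.le_floor ((hdiv N hN).trans ?_)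
    have hL2 : ((L : ℝ) + 1) ≤ 2 * H := by
      have : (L : ℝ) ≤ H := by exact_mod_cast hLH
      linarith
    have h1 : (N : ℝ) ≤ c₁ * (H : ℝ) ^ k := by
      calc (N : ℝ) ≤ 2 * e ^ 2 * e.factorial * 2 ^ e * ((L : ℝ) + 1) ^ k := by exact_mod_cast hNle
        _ ≤ 2 * e ^ 2 * e.factorial * 2 ^ e * (2 * (H : ℝ)) ^ k := by gcongr
        _ = _ := by rw [hc₁, mul_pow]; ring
    calc C₀ * (N : ℝ) ^ (ε / k) ≤ C₀ * (c₁ * (H : ℝ) ^ k) ^ (ε / k) := by gcongr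
      _ = c₂ * (H : ℝ) ^ ε := by
        rw [Real.mul_rpow (by positivity) (by positivity), ← Real.rpow_natCast (H : ℝ) k,
          ← Real.rpow_mul (by positivity), mul_div_cancel₀ _ hk0.ne', hc₂]
        ring
  have hE : ∀ g ∈ ({fun x : ℤ => f₁.eval (x : ZMod p), fun x : ℤ => f₂.eval (x : ZMod p),
      fun x : ℤ => f₃.eval (x : ZMod p), fun x : ℤ => f₄.eval (x : ZMod p)} : Set (ℤ → ZMod p)), ∀ s : ℤ,
      (energyQuads (Finset.Icc s (s + L)) g).card ≤ (2 * e * D + e ^ 2 + e + 1) * (L + 1) ^ 2 := by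
    have hf' : ∀ f : (ZMod p)[X], 2 ≤ f.natDegree ∧ f.natDegree ≤ e → ∀ s : ℤ,
        (energyQuads (Finset.Icc s (s + L)) fun x => f.eval (x : ZMod p)).card ≤
          (2 * e * D + e ^ 2 + e + 1) * (L + 1) ^ 2 := by
      intro f hf s
      refine (card_energyQuads_shift_le _ _ _).trans ?_
      have := card_energyQuads_zmod_le (f := taylor (s : ZMod p) f) (e := e) (L := L) (D := D)
        (by omega) (by omega) (factorial_mul_prod_two_mul_pow_lt (by omega) hp.out.pos hHp) hD
        (by simpa using hf.1) (by simpa using hf.2)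
      simpa [taylor_eval] using this
    intro g hg s
    simp only [Set.mem_insert_iff, Set.mem_singleton_iff] at hg
    rcases hg with rfl | rfl | rfl | rfl <;> exact hf' _ (hf _ (by simp)) s
  have hmain := card_quadSols_Icc_le (show 1 ≤ K by omega) hE
  have hH1' : (1 : ℝ) ≤ (H : ℝ) ^ ε := Real.one_le_rpow hH1 hε.le
  have hL2 : ((L : ℝ) + 1) ≤ 2 * H := by
    have : (L : ℝ) ≤ H := by exact_mod_cast hLH
    linarith
  calc _ ≤ (((2 * K + 1) ^ 4 * ((2 * e * D + e ^ 2 + e + 1) * (L + 1) ^ 2) : ℕ) : ℝ) := by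
        exact_mod_cast hmain
    _ = (2 * K + 1) ^ 4 * ((2 * e * D + (e ^ 2 + e + 1) * 1) * ((L : ℝ) + 1) ^ 2) := by
        push_cast; ring
    _ ≤ (2 * K + 1) ^ 4 * ((2 * e * (c₂ * (H : ℝ) ^ ε) + (e ^ 2 + e + 1) * (H : ℝ) ^ ε) *
          (2 * H) ^ 2) := by gcongr
    _ = _ := by
        rw [Real.rpow_add (by positivity), Real.rpow_two]
        ring

/-- The solutions of `g₁ x + g₂ y = g₃ z` with `x, y, z ∈ A`. -/
def tripleSols {R : Type*} [Add R] [DecidableEq R] (A : Finset ℤ) (g₁ g₂ g₃ : ℤ → R) :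
    Finset ((ℤ × ℤ) × ℤ) :=
  ((A ×ˢ A) ×ˢ A).filter fun q => g₁ q.1.1 + g₂ q.1.2 = g₃ q.2

theorem sq_card_tripleSols_le {F : Type*} [Add F] [Fintype F] [DecidableEq F]
    (A : Finset ℤ) (g₁ g₂ g₃ : ℤ → F) :
    (tripleSols A g₁ g₂ g₃).card ^ 2 ≤ (quadSols A A A A g₁ g₂ g₁ g₂).card *
      ((A ×ˢ A).filter fun z => g₃ z.1 = g₃ z.2).card :=
  sq_card_filter_eq_le (A ×ˢ A) A (fun z => g₁ z.1 + g₂ z.2) g₃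

/-! ### Coordinate projections of subspaces and counting in boxes. -/

theorem exists_finset_linearIndepOn_spanning {F V ι : Type*} [Field F] [AddCommGroup V]
    [Module F V] [Fintype ι] (v : ι → V) :
    ∃ R : Finset ι, LinearIndepOn F v (R : Set ι) ∧
      ∀ i, ∃ c : ι → F, ∑ k ∈ R, c k • v k = v i := by
  classical
  obtain ⟨b, -, -, hb, hli⟩ :=
    exists_linearIndepOn_extension (linearIndepOn_empty F v) (Set.empty_subset Set.univ)
  refine ⟨b.toFinset, by simpa using hli, fun i => ?_⟩
  rw [← Submodule.mem_span_image_finset_iff_exists_fun', Set.coe_toFinset]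
  exact hb ⟨i, trivial, rfl⟩

/-- A subspace of `F ^ κ` projects injectively to some set of `dim W` coordinates. -/
theorem exists_finset_card_eq_finrank_injOn {F κ : Type*} [Field F] [Fintype κ]
    (W : Submodule F (κ → F)) :
    ∃ J : Finset κ, J.card = Module.finrank F W ∧
      ∀ w ∈ W, (∀ j ∈ J, w j = 0) → w = 0 := by
  classical
  -- A maximal independent set of coordinate functionals on `W`: independence bounds its size by the
  -- dimension of the dual, and spanning makes the projection to `J` injective.
  obtain ⟨J, hJ, hspan⟩ := exists_finset_linearIndepOn_spanning (F := F)
    (fun j : κ => (LinearMap.proj j : (κ → F) →ₗ[F] F).comp W.subtype)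
  have hinj : ∀ w ∈ W, (∀ j ∈ J, w j = 0) → w = 0 := by
    intro w hw h
    funext i
    obtain ⟨c, hc⟩ := hspan i
    have := LinearMap.congr_fun hc ⟨w, hw⟩
    simp only [LinearMap.coe_sum, Finset.sum_apply, LinearMap.smul_apply, LinearMap.comp_apply,
      Submodule.subtype_apply, LinearMap.proj_apply] at this
    rw [← this, Pi.zero_apply]
    exact Finset.sum_eq_zero fun j hj => by rw [h j hj, smul_zero]
  refine ⟨J, le_antisymm ?_ ?_, hinj⟩
  · have := LinearIndependent.fintype_card_le_finrank hJ
    rw [Subspace.dual_finrank_eq] at this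
    simpa using this
  · let φ : W →ₗ[F] (J → F) := LinearMap.pi fun j => (LinearMap.proj (j : κ)).comp W.subtype
    have hφ : Function.Injective φ := by
      rw [← LinearMap.ker_eq_bot, LinearMap.ker_eq_bot']
      intro w hw
      have := hinj w w.2 fun j hj => congrFun hw ⟨j, hj⟩
      exact Subtype.ext this
    simpa using LinearMap.finrank_le_finrank_of_injective hφ

/-- The family that agrees with `y` on `J` and vanishes elsewhere. -/
def maskOn {κ α : Type*} [DecidableEq κ] [Zero α] (J : Finset κ) (y : κ → α) : κ → α :=
  fun j => if j ∈ J then y j else 0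

theorem maskOn_of_mem {κ α : Type*} [DecidableEq κ] [Zero α] {J : Finset κ} {y : κ → α} {j : κ}
    (h : j ∈ J) : maskOn J y j = y j := if_pos h

theorem maskOn_of_notMem {κ α : Type*} [DecidableEq κ] [Zero α] {J : Finset κ} {y : κ → α} {j : κ}
    (h : j ∉ J) : maskOn J y j = 0 := if_neg h

theorem card_piFinset_le_pow {κ α : Type*} [Fintype κ] [DecidableEq κ] {A : κ → Finset α}
    {J : Finset κ} {Q : ℕ} (h : ∀ j ∈ J, (A j).card ≤ Q) (h' : ∀ j, j ∉ J → (A j).card ≤ 1) :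
    (Fintype.piFinset A).card ≤ Q ^ J.card := by
  rw [Fintype.card_piFinset]
  calc ∏ j, (A j).card ≤ ∏ j, if j ∈ J then Q else 1 := by
        refine Finset.prod_le_prod' fun j _ => ?_
        split_ifs with hj
        · exact h j hj
        · exact h' j hj
    _ = Q ^ J.card := by rw [Finset.prod_ite_mem, Finset.univ_inter, Finset.prod_const]

/-- Vectors in a box whose image under a coordinate-wise `e`-to-one map lies in a subspace. -/
theorem card_filter_mem_submodule_le {F κ : Type*} [Field F] [DecidableEq F] [Fintype κ]
    [DecidableEq κ] (A : κ → Finset ℤ) (g : κ → ℤ → F) {e Q s : ℕ} (hQ : 1 ≤ Q)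
    (hA : ∀ j, (A j).card ≤ Q) (hg : ∀ j c, ((A j).filter fun x => g j x = c).card ≤ e)
    (W : Submodule F (κ → F)) [DecidablePred (· ∈ W)] (hW : Module.finrank F W ≤ s) :
    ((Fintype.piFinset A).filter fun y => (fun j => g j (y j)) ∈ W).card ≤
      e ^ Fintype.card κ * Q ^ s := by
  obtain ⟨J, hJ, hinj⟩ := exists_finset_card_eq_finrank_injOn W
  set Y := (Fintype.piFinset A).filter fun y => (fun j => g j (y j)) ∈ W with hY
  refine (Finset.card_le_mul_card_image (f := maskOn J) Y (e ^ Fintype.card κ)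
    fun a ha => ?_).trans (Nat.mul_le_mul_left _ ?_)
  · obtain ⟨y₀, hy₀, rfl⟩ := Finset.mem_image.1 ha
    have hsub : (Y.filter fun y => maskOn J y = maskOn J y₀) ⊆
        Fintype.piFinset fun j => (A j).filter fun x => g j x = g j (y₀ j) := by
      intro y hy
      rw [Finset.mem_filter, hY, Finset.mem_filter, Fintype.mem_piFinset] at hy
      obtain ⟨⟨hyA, hyW⟩, hyJ⟩ := hy
      -- Agreement of `y` and `y₀` on `J` forces their images to agree in every coordinate, leaving
      -- at most `e` choices for each entry.
      have hdiff := hinj _ (W.sub_mem hyW (Finset.mem_filter.1 hy₀).2) fun j hj => by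
        have := congrFun hyJ j
        rw [maskOn_of_mem hj, maskOn_of_mem hj] at this
        simp [this]
      rw [Fintype.mem_piFinset]
      intro j
      exact Finset.mem_filter.2 ⟨hyA j, sub_eq_zero.1 (congrFun hdiff j)⟩
    refine (Finset.card_le_card hsub).trans ?_
    exact card_piFinset_le_pow (J := Finset.univ) (fun j _ => hg j _) (by simp)
  · have hsub : Y.image (maskOn J) ⊆ Fintype.piFinset fun j => if j ∈ J then A j else {0} := by
      intro a ha
      obtain ⟨y, hy, rfl⟩ := Finset.mem_image.1 ha
      rw [Fintype.mem_piFinset]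
      intro j
      have := Fintype.mem_piFinset.1 (Finset.mem_filter.1 hy).1 j
      by_cases hj : j ∈ J <;> simp [maskOn, hj, this]
    calc _ ≤ _ := Finset.card_le_card hsub
      _ ≤ Q ^ J.card := card_piFinset_le_pow (fun j hj => by simpa [hj] using hA j)
          fun j hj => by simp [hj]
      _ ≤ Q ^ s := Nat.pow_le_pow_right hQ (hJ ▸ hW)

/-! ### Counting a single column that satisfies a fixed relation. -/

/-- Vectors supported on `T`, in a box there, which satisfy
`g i₀ (y i₀) = ∑ k ∈ S, c k * g k (y k)`. -/
def colSols {F ι : Type*} [Field F] [DecidableEq F] [Fintype ι] [DecidableEq ι] (I : Finset ℤ)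
    (T : Finset ι) (g : ι → ℤ → F) (i₀ : ι) (S : Finset ι) (c : ι → F) : Finset (ι → ℤ) :=
  (Fintype.piFinset fun i => if i ∈ T then I else {0}).filter fun y =>
    g i₀ (y i₀) = ∑ k ∈ S, c k * g k (y k)

/-- Bounding `colSols` by fixing all coordinates outside `U`. -/
theorem card_colSols_le {F ι : Type*} [Field F] [DecidableEq F] [Fintype ι] [DecidableEq ι]
    (I : Finset ℤ) {T : Finset ι} (g : ι → ℤ → F) (i₀ : ι) (S : Finset ι) (c : ι → F)
    {U : Finset ι} (hU : U ⊆ T) {N : ℕ}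
    (h : ∀ y₀ ∈ colSols I T g i₀ S c, ((colSols I T g i₀ S c).filter fun y =>
      maskOn (T \ U) y = maskOn (T \ U) y₀).card ≤ N) :
    (colSols I T g i₀ S c).card ≤ N * I.card ^ (T.card - U.card) := by
  refine (Finset.card_le_mul_card_image (f := maskOn (T \ U)) _ N fun a ha => ?_).trans
    (Nat.mul_le_mul_left _ ?_)
  · obtain ⟨y₀, hy₀, rfl⟩ := Finset.mem_image.1 ha
    exact h y₀ hy₀
  · rw [← Finset.card_sdiff_of_subset hU]
    have hsub : (colSols I T g i₀ S c).image (maskOn (T \ U)) ⊆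
        Fintype.piFinset fun j => if j ∈ T \ U then I else {0} := by
      intro a ha
      obtain ⟨y, hy, rfl⟩ := Finset.mem_image.1 ha
      rw [Fintype.mem_piFinset]
      intro j
      have := Fintype.mem_piFinset.1 (Finset.mem_filter.1 hy).1 j
      by_cases hj : j ∈ T \ U
      · simp only [(Finset.mem_sdiff.1 hj).1, if_true] at this
        simpa only [maskOn_of_mem hj, if_pos hj] using this
      · simp only [maskOn_of_notMem hj, if_neg hj, Finset.mem_singleton]
    exact (Finset.card_le_card hsub).trans
      (card_piFinset_le_pow (fun j hj => by simp only [if_pos hj]; rfl)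
        fun j hj => by simp only [if_neg hj]; simp)

theorem eq_off_of_maskOn_eq {F ι : Type*} [Field F] [DecidableEq F] [Fintype ι] [DecidableEq ι]
    {I : Finset ℤ} {T : Finset ι} {g : ι → ℤ → F} {i₀ : ι} {S : Finset ι} {c : ι → F}
    {U : Finset ι} {y y₀ : ι → ℤ} (hy : y ∈ colSols I T g i₀ S c)
    (hy₀ : y₀ ∈ colSols I T g i₀ S c) (h : maskOn (T \ U) y = maskOn (T \ U) y₀) {k : ι}
    (hk : k ∉ U) : y k = y₀ k := by
  by_cases hkT : k ∈ T
  · have := congrFun h k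
    rwa [maskOn_of_mem (Finset.mem_sdiff.2 ⟨hkT, hk⟩),
      maskOn_of_mem (Finset.mem_sdiff.2 ⟨hkT, hk⟩)] at this
  · have h1 := Fintype.mem_piFinset.1 (Finset.mem_filter.1 hy).1 k
    have h2 := Fintype.mem_piFinset.1 (Finset.mem_filter.1 hy₀).1 k
    simp only [if_neg hkT, Finset.mem_singleton] at h1 h2
    rw [h1, h2]

theorem mem_of_mem_colSols {F ι : Type*} [Field F] [DecidableEq F] [Fintype ι] [DecidableEq ι]
    {I : Finset ℤ} {T : Finset ι} {g : ι → ℤ → F} {i₀ : ι} {S : Finset ι} {c : ι → F}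
    {y : ι → ℤ} (hy : y ∈ colSols I T g i₀ S c) {k : ι} (hk : k ∈ T) : y k ∈ I := by
  have h1 := Fintype.mem_piFinset.1 (Finset.mem_filter.1 hy).1 k
  simpa only [if_pos hk] using h1

/-- The entry in row `i₀` is determined up to `e` choices by the others, because `i₀ ∉ S`. This
bound serves relations with at most one term. -/
theorem card_colSols_le_of_fiber {F ι : Type*} [Field F] [DecidableEq F] [Fintype ι]
    [DecidableEq ι] (I : Finset ℤ) {T : Finset ι} (g : ι → ℤ → F) {i₀ : ι} {S : Finset ι}
    (c : ι → F) (h₀ : i₀ ∈ T) (hS : i₀ ∉ S) {e : ℕ}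
    (hg : ∀ b, (I.filter fun x => g i₀ x = b).card ≤ e) :
    (colSols I T g i₀ S c).card ≤ e * I.card ^ (T.card - 1) := by
  have := card_colSols_le I g i₀ S c (U := {i₀}) (by simpa using h₀) (N := e) fun y₀ hy₀ => by
    refine le_trans (Finset.card_le_card_of_injOn (fun y => y i₀) (fun y hy => ?_)
      (fun y hy y' hy' h => ?_)) (hg (g i₀ (y₀ i₀)))
    · obtain ⟨hy, hm⟩ := Finset.mem_filter.1 (Finset.mem_coe.1 hy)
      refine Finset.mem_coe.2 (Finset.mem_filter.2 ⟨mem_of_mem_colSols hy h₀, ?_⟩)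
      rw [(Finset.mem_filter.1 hy).2, (Finset.mem_filter.1 hy₀).2]
      refine Finset.sum_congr rfl fun k hk => ?_
      rw [eq_off_of_maskOn_eq hy hy₀ hm
        (Finset.notMem_singleton.2 (ne_of_mem_of_not_mem hk hS))]
    · obtain ⟨hy, hm⟩ := Finset.mem_filter.1 (Finset.mem_coe.1 hy)
      obtain ⟨hy', hm'⟩ := Finset.mem_filter.1 (Finset.mem_coe.1 hy')
      funext k
      by_cases hk : k = i₀
      · exact hk ▸ h
      · exact eq_off_of_maskOn_eq hy hy' (hm.trans hm'.symm) (Finset.notMem_singleton.2 hk)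
  simpa using this

/-- With all entries outside rows `i₀, k₁, k₂` frozen, the remaining terms form a constant `b` that
is absorbed into `f i₀`. Nonzero coefficients preserve the degrees, so a three-term equation of the
allowed kind remains. -/
theorem card_colSols_le_of_triple {p : ℕ} [Fact p.Prime] {ι : Type*} [Fintype ι]
    [DecidableEq ι] (I : Finset ℤ) {e N : ℕ}
    (hN : ∀ f₁ f₂ f₃ : (ZMod p)[X],
      (∀ f ∈ ({f₁, f₂, f₃} : Set (ZMod p)[X]), 2 ≤ f.natDegree ∧ f.natDegree ≤ e) →
      (tripleSols I (fun x => f₁.eval (x : ZMod p)) (fun x => f₂.eval (x : ZMod p))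
        (fun x => f₃.eval (x : ZMod p))).card ≤ N)
    {T : Finset ι} {f : ι → (ZMod p)[X]} (hf : ∀ i, 2 ≤ (f i).natDegree ∧ (f i).natDegree ≤ e)
    {i₀ : ι} {S : Finset ι} {c : ι → ZMod p} (h₀ : i₀ ∈ T) (hS : i₀ ∉ S) (hST : S ⊆ T)
    (hc : ∀ k ∈ S, c k ≠ 0) {k₁ k₂ : ι} (h₁ : k₁ ∈ S) (h₂ : k₂ ∈ S) (h₁₂ : k₁ ≠ k₂) :
    (colSols I T (fun i x => (f i).eval (x : ZMod p)) i₀ S c).card ≤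
      N * I.card ^ (T.card - 3) := by
  have h₀₁ : i₀ ≠ k₁ := fun h => hS (h ▸ h₁)
  have h₀₂ : i₀ ≠ k₂ := fun h => hS (h ▸ h₂)
  have hcard : ({i₀, k₁, k₂} : Finset ι).card = 3 := Finset.card_eq_three.2
    ⟨_, _, _, h₀₁, h₀₂, h₁₂, rfl⟩
  rw [← hcard]
  refine card_colSols_le I _ i₀ S c (U := {i₀, k₁, k₂})
    (by simp [Finset.insert_subset_iff, h₀, hST h₁, hST h₂]) fun y₀ hy₀ => ?_
  set b := ∑ k ∈ (S.erase k₁).erase k₂, c k * (f k).eval (y₀ k : ZMod p) with hb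
  refine le_trans (Finset.card_le_card_of_injOn (fun y => ((y k₁, y k₂), y i₀))
    (fun y hy => ?_) (fun y hy y' hy' h => ?_)) (hN (C (c k₁) * f k₁) (C (c k₂) * f k₂)
      (f i₀ - C b) ?_)
  · obtain ⟨hy, hm⟩ := Finset.mem_filter.1 (Finset.mem_coe.1 hy)
    rw [Finset.mem_coe, tripleSols, Finset.mem_filter]
    refine ⟨by simp [mem_of_mem_colSols hy h₀, mem_of_mem_colSols hy (hST h₁),
      mem_of_mem_colSols hy (hST h₂)], ?_⟩
    have heq := (Finset.mem_filter.1 hy).2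
    rw [← Finset.add_sum_erase _ _ h₁,
      ← Finset.add_sum_erase _ _ (Finset.mem_erase.2 ⟨h₁₂.symm, h₂⟩)] at heq
    have hb' : ∑ k ∈ (S.erase k₁).erase k₂, c k * (f k).eval (y k : ZMod p) = b := by
      refine Finset.sum_congr rfl fun k hk => ?_
      simp only [Finset.mem_erase] at hk
      rw [eq_off_of_maskOn_eq hy hy₀ hm]
      simp only [Finset.mem_insert, Finset.mem_singleton, not_or]
      exact ⟨fun h => hS (h ▸ hk.2.2), hk.2.1, hk.1⟩
    rw [hb'] at heq
    simp only [eval_mul, eval_C, eval_sub, heq]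
    ring
  · obtain ⟨hy, hm⟩ := Finset.mem_filter.1 (Finset.mem_coe.1 hy)
    obtain ⟨hy', hm'⟩ := Finset.mem_filter.1 (Finset.mem_coe.1 hy')
    simp only [Prod.mk.injEq] at h
    funext k
    by_cases hk : k ∈ ({i₀, k₁, k₂} : Finset ι)
    · simp only [Finset.mem_insert, Finset.mem_singleton] at hk
      rcases hk with rfl | rfl | rfl
      exacts [h.2, h.1.1, h.1.2]
    · exact eq_off_of_maskOn_eq hy hy' (hm.trans hm'.symm) hk
  · intro q hq
    simp only [Set.mem_insert_iff, Set.mem_singleton_iff] at hq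
    rcases hq with rfl | rfl | rfl
    · rw [natDegree_C_mul (hc _ h₁)]; exact hf _
    · rw [natDegree_C_mul (hc _ h₂)]; exact hf _
    · rw [natDegree_sub_C]; exact hf _

/-- The same freezing with a fourth free row `k₃`, whose term is moved to the other side with its
sign changed. -/
theorem card_colSols_le_of_quad {p : ℕ} [Fact p.Prime] {ι : Type*} [Fintype ι]
    [DecidableEq ι] (I : Finset ℤ) {e N : ℕ}
    (hN : ∀ f₁ f₂ f₃ f₄ : (ZMod p)[X],
      (∀ f ∈ ({f₁, f₂, f₃, f₄} : Set (ZMod p)[X]), 2 ≤ f.natDegree ∧ f.natDegree ≤ e) →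
      (quadSols I I I I (fun x => f₁.eval (x : ZMod p)) (fun x => f₂.eval (x : ZMod p))
        (fun x => f₃.eval (x : ZMod p)) (fun x => f₄.eval (x : ZMod p))).card ≤ N)
    {T : Finset ι} {f : ι → (ZMod p)[X]} (hf : ∀ i, 2 ≤ (f i).natDegree ∧ (f i).natDegree ≤ e)
    {i₀ : ι} {S : Finset ι} {c : ι → ZMod p} (h₀ : i₀ ∈ T) (hS : i₀ ∉ S) (hST : S ⊆ T)
    (hc : ∀ k ∈ S, c k ≠ 0) {k₁ k₂ k₃ : ι} (h₁ : k₁ ∈ S) (h₂ : k₂ ∈ S) (h₃ : k₃ ∈ S)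
    (h₁₂ : k₁ ≠ k₂) (h₁₃ : k₁ ≠ k₃) (h₂₃ : k₂ ≠ k₃) :
    (colSols I T (fun i x => (f i).eval (x : ZMod p)) i₀ S c).card ≤
      N * I.card ^ (T.card - 4) := by
  have h₀₁ : i₀ ≠ k₁ := fun h => hS (h ▸ h₁)
  have h₀₂ : i₀ ≠ k₂ := fun h => hS (h ▸ h₂)
  have h₀₃ : i₀ ≠ k₃ := fun h => hS (h ▸ h₃)
  have hcard : ({i₀, k₁, k₂, k₃} : Finset ι).card = 4 := by
    rw [Finset.card_insert_of_notMem (by simp [h₀₁, h₀₂, h₀₃]),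
      Finset.card_eq_three.2 ⟨_, _, _, h₁₂, h₁₃, h₂₃, rfl⟩]
  rw [← hcard]
  refine card_colSols_le I _ i₀ S c (U := {i₀, k₁, k₂, k₃})
    (by simp [Finset.insert_subset_iff, h₀, hST h₁, hST h₂, hST h₃]) fun y₀ hy₀ => ?_
  set b := ∑ k ∈ ((S.erase k₁).erase k₂).erase k₃, c k * (f k).eval (y₀ k : ZMod p) with hb
  refine le_trans (Finset.card_le_card_of_injOn (fun y => ((y k₁, y k₂), (y i₀, y k₃)))
    (fun y hy => ?_) (fun y hy y' hy' h => ?_)) (hN (C (c k₁) * f k₁) (C (c k₂) * f k₂)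
      (f i₀ - C b) (C (-c k₃) * f k₃) ?_)
  · obtain ⟨hy, hm⟩ := Finset.mem_filter.1 (Finset.mem_coe.1 hy)
    rw [Finset.mem_coe, mem_quadSols]
    refine ⟨by simp [mem_of_mem_colSols hy h₀, mem_of_mem_colSols hy (hST h₁),
      mem_of_mem_colSols hy (hST h₂), mem_of_mem_colSols hy (hST h₃)], ?_⟩
    have heq := (Finset.mem_filter.1 hy).2
    rw [← Finset.add_sum_erase _ _ h₁,
      ← Finset.add_sum_erase _ _ (Finset.mem_erase.2 ⟨h₁₂.symm, h₂⟩),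
      ← Finset.add_sum_erase _ _ (Finset.mem_erase.2
        ⟨h₂₃.symm, Finset.mem_erase.2 ⟨h₁₃.symm, h₃⟩⟩)] at heq
    have hb' : ∑ k ∈ ((S.erase k₁).erase k₂).erase k₃, c k * (f k).eval (y k : ZMod p) = b := by
      refine Finset.sum_congr rfl fun k hk => ?_
      simp only [Finset.mem_erase] at hk
      rw [eq_off_of_maskOn_eq hy hy₀ hm]
      simp only [Finset.mem_insert, Finset.mem_singleton, not_or]
      exact ⟨fun h => hS (h ▸ hk.2.2.2), hk.2.2.1, hk.2.1, hk.1⟩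
    rw [hb'] at heq
    simp only [eval_mul, eval_C, eval_sub, heq]
    ring
  · obtain ⟨hy, hm⟩ := Finset.mem_filter.1 (Finset.mem_coe.1 hy)
    obtain ⟨hy', hm'⟩ := Finset.mem_filter.1 (Finset.mem_coe.1 hy')
    simp only [Prod.mk.injEq] at h
    funext k
    by_cases hk : k ∈ ({i₀, k₁, k₂, k₃} : Finset ι)
    · simp only [Finset.mem_insert, Finset.mem_singleton] at hk
      rcases hk with rfl | rfl | rfl | rfl
      exacts [h.2.1, h.1.1, h.1.2, h.2.2]
    · exact eq_off_of_maskOn_eq hy hy' (hm.trans hm'.symm) hk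
  · intro q hq
    simp only [Set.mem_insert_iff, Set.mem_singleton_iff] at hq
    rcases hq with rfl | rfl | rfl | rfl
    · rw [natDegree_C_mul (hc _ h₁)]; exact hf _
    · rw [natDegree_C_mul (hc _ h₂)]; exact hf _
    · rw [natDegree_sub_C]; exact hf _
    · rw [natDegree_C_mul (neg_ne_zero.2 (hc _ h₃))]; exact hf _

/-! ### Counting arrays with a given rank pattern. -/

open Classical in
/-- Vectors in a box whose image under a coordinate-wise `e`-to-one map is a combination of the
vectors `v k`, `k ∈ S`. -/
theorem card_filter_linearComb_le {F ι κ : Type*} [Field F] [Fintype κ]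
    (A : κ → Finset ℤ) (g : κ → ℤ → F) {e Q : ℕ} (hQ : 1 ≤ Q)
    (hA : ∀ j, (A j).card ≤ Q) (hg : ∀ j c, ((A j).filter fun x => g j x = c).card ≤ e)
    (v : ι → κ → F) (S : Finset ι) :
    ((Fintype.piFinset A).filter fun y => ∃ c : ι → F, ∀ j,
      g j (y j) = ∑ k ∈ S, c k * v k j).card ≤ e ^ Fintype.card κ * Q ^ S.card := by
  have hW : Module.finrank F (Submodule.span F (v '' (S : Set ι))) ≤ S.card := by
    rw [← Finset.coe_image]
    exact (finrank_span_finset_le_card _).trans Finset.card_image_le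
  refine le_trans (Finset.card_le_card fun y hy => ?_)
    (card_filter_mem_submodule_le A g hQ hA hg _ hW)
  rw [Finset.mem_filter] at hy ⊢
  refine ⟨hy.1, ?_⟩
  obtain ⟨c, hc⟩ := hy.2
  rw [Submodule.mem_span_image_finset_iff_exists_fun']
  refine ⟨c, funext fun j => ?_⟩
  simp [hc j]

/-- In the matrix with entries `g i j (x i j)` the `R × J` minor is nondegenerate, row `i₀` is a
combination with nonzero coefficients of the rows in `S`, and every row outside `R` is a
combination of at most `|S|` rows in `R`. -/
def IsRankPattern {F ι κ : Type*} [Field F] (g : ι → κ → ℤ → F) (R : Finset ι) (J : Finset κ)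
    (i₀ : ι) (S : Finset ι) (x : ι → κ → ℤ) : Prop :=
  (∀ d : ι → F, (∀ j ∈ J, ∑ k ∈ R, d k * g k j (x k j) = 0) → ∀ k ∈ R, d k = 0) ∧
  (∃ c : ι → F, (∀ k ∈ S, c k ≠ 0) ∧ ∀ j, g i₀ j (x i₀ j) = ∑ k ∈ S, c k * g k j (x k j)) ∧
  ∀ i, i ∉ R → ∃ S' ⊆ R, S'.card ≤ S.card ∧
    ∃ c : ι → F, ∀ j, g i j (x i j) = ∑ k ∈ S', c k * g k j (x k j)

section Counting

variable {F ι κ : Type*} [Field F] [Fintype ι] [Fintype κ]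

-- Once the rows in `insert i₀ R` are known, each other row lies in the span of at most `S.card` of
-- them; the factor `2 ^ Fintype.card ι` pays for the choice of which ones.
open Classical in
theorem card_filter_le_of_rows (I : Finset ℤ) {e : ℕ} (hI : 1 ≤ I.card) {g : ι → κ → ℤ → F}
    (hg : ∀ i j b, (I.filter fun x => g i j x = b).card ≤ e) {R : Finset ι} {J : Finset κ}
    {i₀ : ι} {S : Finset ι} (hi₀ : i₀ ∉ R) :
    ((Fintype.piFinset fun _ : ι => Fintype.piFinset fun _ : κ => I).filter
      (IsRankPattern g R J i₀ S)).card ≤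
    (2 ^ Fintype.card ι * (e ^ Fintype.card κ * I.card ^ S.card)) ^
        (Fintype.card ι - (R.card + 1)) *
      (((Fintype.piFinset fun _ : ι => Fintype.piFinset fun _ : κ => I).filter
        (IsRankPattern g R J i₀ S)).image (maskOn (insert i₀ R))).card := by
  set X := (Fintype.piFinset fun _ : ι => Fintype.piFinset fun _ : κ => I).filter
      (IsRankPattern g R J i₀ S) with hX
  refine Finset.card_le_mul_card_image X _ fun a _ => ?_
  let B : ι → Finset (κ → ℤ) := fun i => if i ∈ insert i₀ R then {a i} else
    ((Finset.univ : Finset (Finset ι)).filter fun S' => S'.card ≤ S.card).biUnion fun S' =>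
      (Fintype.piFinset fun _ : κ => I).filter fun y => ∃ c : ι → F, ∀ j,
        g i j (y j) = ∑ k ∈ S', c k * g k j (a k j)
  have hsub : X.filter (fun x => maskOn (insert i₀ R) x = a) ⊆ Fintype.piFinset B := by
    intro x hx
    obtain ⟨hxX, rfl⟩ := Finset.mem_filter.1 hx
    obtain ⟨hxI, -, -, hrow⟩ := Finset.mem_filter.1 hxX
    rw [Fintype.mem_piFinset] at hxI ⊢
    intro i
    by_cases hi : i ∈ insert i₀ R
    · simp only [B, if_pos hi, maskOn_of_mem hi, Finset.mem_singleton]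
    · simp only [B, if_neg hi, Finset.mem_biUnion, Finset.mem_filter, Finset.mem_univ, true_and]
      obtain ⟨S', hS'R, hS', c, hc⟩ := hrow i fun h => hi (Finset.mem_insert_of_mem h)
      refine ⟨S', hS', hxI i, c, fun j => (hc j).trans (Finset.sum_congr rfl fun k hk => ?_)⟩
      rw [maskOn_of_mem (Finset.mem_insert_of_mem (hS'R hk))]
  have hcard : (insert i₀ R)ᶜ.card = Fintype.card ι - (R.card + 1) := by
    rw [Finset.card_compl, Finset.card_insert_of_notMem hi₀]
  rw [← hcard]
  refine (Finset.card_le_card hsub).trans (card_piFinset_le_pow (fun i hi => ?_) fun i hi => ?_)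
  · simp only [B, if_neg (Finset.mem_compl.1 hi)]
    refine (Finset.card_biUnion_le_card_mul _ _ (e ^ Fintype.card κ * I.card ^ S.card)
      fun S' hS' => ?_).trans (Nat.mul_le_mul_right _ ?_)
    · refine (card_filter_linearComb_le (fun _ => I) (g i) hI (fun _ => le_rfl) (hg i)
        (fun k j => g k j (a k j)) S').trans ?_
      exact Nat.mul_le_mul_left _ (Nat.pow_le_pow_right hI (Finset.mem_filter.1 hS').2)
    · refine (Finset.card_filter_le _ _).trans ?_
      simp
  · rw [Finset.mem_compl, not_not] at hi
    simp only [B, if_pos hi, Finset.card_singleton, le_refl]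

-- The entries on `J` determine the coefficients of the relation for row `i₀`, because the minor is
-- nondegenerate. Every column outside `J` then satisfies one and the same relation and is counted
-- by `colSols`.
open Classical in
theorem card_image_mask_le_of_cols (I : Finset ℤ) {g : ι → κ → ℤ → F} {R : Finset ι}
    {J : Finset κ} {i₀ : ι} {S : Finset ι} (hSR : S ⊆ R) {B : ℕ}
    (hB : ∀ j, ∀ c : ι → F, (∀ k ∈ S, c k ≠ 0) →
      (colSols I (insert i₀ R) (fun i => g i j) i₀ S c).card ≤ B) :
    (((Fintype.piFinset fun _ : ι => Fintype.piFinset fun _ : κ => I).filter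
        (IsRankPattern g R J i₀ S)).image (maskOn (insert i₀ R))).card ≤
    B ^ (Fintype.card κ - J.card) *
      ((((Fintype.piFinset fun _ : ι => Fintype.piFinset fun _ : κ => I).filter
        (IsRankPattern g R J i₀ S)).image (maskOn (insert i₀ R))).image
          fun y i => maskOn J (y i)).card := by
  set T := insert i₀ R with hT
  set X := (Fintype.piFinset fun _ : ι => Fintype.piFinset fun _ : κ => I).filter
      (IsRankPattern g R J i₀ S) with hX
  refine Finset.card_le_mul_card_image _ _ fun a ha => ?_
  obtain ⟨y₀, hy₀, rfl⟩ := Finset.mem_image.1 ha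
  obtain ⟨x₀, hx₀, rfl⟩ := Finset.mem_image.1 hy₀
  obtain ⟨-, hmin, ⟨c₀, hc₀, hrow₀⟩, -⟩ := Finset.mem_filter.1 hx₀
  let A : κ → Finset (ι → ℤ) := fun j => if j ∈ J then {fun i => maskOn T x₀ i j} else
    colSols I T (fun i => g i j) i₀ S c₀
  have hi₀T : i₀ ∈ T := Finset.mem_insert_self _ _
  have hRT : ∀ {k}, k ∈ R → k ∈ T := fun h => Finset.mem_insert_of_mem h
  have hle : ((X.image (maskOn T)).filter
      fun y => (fun i => maskOn J (y i)) = fun i => maskOn J (maskOn T x₀ i)).card ≤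
      (Fintype.piFinset A).card := by
    refine Finset.card_le_card_of_injOn (fun y j i => y i j) (fun y hy => ?_)
      (fun y _ y' _ h => funext fun i => funext fun j => congrFun (congrFun h j) i)
    obtain ⟨hy, hyJ⟩ := Finset.mem_filter.1 (Finset.mem_coe.1 hy)
    obtain ⟨x, hx, rfl⟩ := Finset.mem_image.1 hy
    obtain ⟨hxI, -, ⟨c, -, hrow⟩, -⟩ := Finset.mem_filter.1 hx
    have hJ : ∀ i, ∀ j ∈ J, maskOn T x i j = maskOn T x₀ i j := by
      intro i j hj
      have := congrFun (congrFun hyJ i) j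
      rwa [maskOn_of_mem hj, maskOn_of_mem hj] at this
    have hTJ : ∀ i ∈ T, ∀ j ∈ J, x i j = x₀ i j := by
      intro i hi j hj
      have := hJ i j hj
      rwa [maskOn_of_mem hi, maskOn_of_mem hi] at this
    have hcc : ∀ k ∈ S, c k = c₀ k := by
      intro k hk
      -- The difference of two coefficient vectors, extended by zero from `S` to `R`, annihilates
      -- the minor.
      have := hmin (fun k => if k ∈ S then c k - c₀ k else 0) (fun j hj => ?_) k (hSR hk)
      · simpa [hk, sub_eq_zero] using this
      · have h1 := hrow j
        rw [hTJ i₀ hi₀T j hj, hrow₀ j] at h1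
        simp only [ite_mul, zero_mul, Finset.sum_ite_mem, Finset.inter_eq_right.2 hSR, sub_mul,
          Finset.sum_sub_distrib]
        rw [h1, sub_eq_zero]
        refine Finset.sum_congr rfl fun k hk => ?_
        rw [hTJ k (hRT (hSR hk)) j hj]
    rw [Finset.mem_coe, Fintype.mem_piFinset]
    intro j
    by_cases hj : j ∈ J
    · simp only [A, if_pos hj, Finset.mem_singleton]
      exact funext fun i => hJ i j hj
    · simp only [A, if_neg hj]
      refine Finset.mem_filter.2 ⟨Fintype.mem_piFinset.2 fun i => ?_, ?_⟩
      · have := Fintype.mem_piFinset.1 (Fintype.mem_piFinset.1 hxI i) j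
        by_cases hi : i ∈ T
        · simpa only [if_pos hi, maskOn_of_mem hi] using this
        · simp only [if_neg hi, maskOn_of_notMem hi, Pi.zero_apply, Finset.mem_singleton]
      · simp only [maskOn_of_mem hi₀T, hrow j]
        refine Finset.sum_congr rfl fun k hk => ?_
        rw [hcc k hk, maskOn_of_mem (hRT (hSR hk))]
  rw [← Finset.card_compl]
  refine hle.trans (card_piFinset_le_pow (fun j hj => ?_) fun j hj => ?_)
  · simp only [A, if_neg (Finset.mem_compl.1 hj)]
    exact hB j c₀ hc₀
  · rw [Finset.mem_compl, not_not] at hj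
    simp only [A, if_pos hj, Finset.card_singleton, le_refl]

-- The rows in `R` are left free on `J`; row `i₀` on `J` then lies in the span of the rows in `S`.
open Classical in
theorem card_image_mask_minor_le (I : Finset ℤ) {e : ℕ} (he : 1 ≤ e) (hI : 1 ≤ I.card)
    {g : ι → κ → ℤ → F} (hg : ∀ i j b, (I.filter fun x => g i j x = b).card ≤ e)
    {R : Finset ι} {J : Finset κ} {i₀ : ι} {S : Finset ι} (hSR : S ⊆ R) :
    ((((Fintype.piFinset fun _ : ι => Fintype.piFinset fun _ : κ => I).filter
        (IsRankPattern g R J i₀ S)).image (maskOn (insert i₀ R))).image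
          fun y i => maskOn J (y i)).card ≤
      e ^ Fintype.card κ * I.card ^ S.card * (I.card ^ J.card) ^ R.card := by
  set T := insert i₀ R with hT
  set X := (Fintype.piFinset fun _ : ι => Fintype.piFinset fun _ : κ => I).filter
      (IsRankPattern g R J i₀ S) with hX
  set Y := (X.image (maskOn T)).image fun y i => maskOn J (y i) with hY
  let A : κ → Finset ℤ := fun j => if j ∈ J then I else {0}
  have hi₀T : i₀ ∈ T := Finset.mem_insert_self _ _
  have hRT : ∀ {k}, k ∈ R → k ∈ T := fun h => Finset.mem_insert_of_mem h
  have hAcard : ∀ j, (A j).card ≤ I.card := by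
    intro j
    by_cases hj : j ∈ J
    · simp [A, hj]
    · simpa [A, hj] using hI
  have hYmem : ∀ y ∈ Y, (∀ i ∈ T, y i ∈ Fintype.piFinset A) ∧ (∀ i, i ∉ T → y i = 0) ∧
      ∃ c : ι → F, ∀ j ∈ J, g i₀ j (y i₀ j) = ∑ k ∈ S, c k * g k j (y k j) := by
    intro y hy
    obtain ⟨y', hy', rfl⟩ := Finset.mem_image.1 hy
    obtain ⟨x, hx, rfl⟩ := Finset.mem_image.1 hy'
    obtain ⟨hxI, hpat⟩ := Finset.mem_filter.1 hx
    obtain ⟨-, ⟨c, -, hc⟩, -⟩ := hpat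
    refine ⟨fun i hi => ?_, fun i hi => ?_, c, fun j hj => ?_⟩
    · rw [Fintype.mem_piFinset]
      intro j
      have := Fintype.mem_piFinset.1 (Fintype.mem_piFinset.1 hxI i) j
      by_cases hj : j ∈ J
      · simpa only [A, if_pos hj, maskOn_of_mem hj, maskOn_of_mem hi] using this
      · simp only [A, if_neg hj, maskOn_of_notMem hj, Finset.mem_singleton]
    · funext j
      simp [maskOn, hi]
    · simp only [maskOn_of_mem hj, maskOn_of_mem hi₀T, hc j]
      refine Finset.sum_congr rfl fun k hk => ?_
      rw [maskOn_of_mem (hRT (hSR hk))]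
  refine (Finset.card_le_mul_card_image (f := maskOn R) Y (e ^ Fintype.card κ * I.card ^ S.card)
    fun a _ => ?_).trans (Nat.mul_le_mul_left _ ?_)
  -- Extension by zero off `J`, so that the bound for subspaces can be used with all of `κ` as index
  -- set.
  · let v : ι → κ → F := fun k j => if j ∈ J then g k j (a k j) else 0
    let W := (Fintype.piFinset A).filter fun y => ∃ c : ι → F, ∀ j,
      (if j ∈ J then g i₀ j (y j) else 0) = ∑ k ∈ S, c k * v k j
    let D : ι → Finset (κ → ℤ) := fun i => if i ∈ R then {a i} else if i = i₀ then W else {0}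
    have hsub : Y.filter (fun y => maskOn R y = a) ⊆ Fintype.piFinset D := by
      intro y hy
      obtain ⟨hyY, rfl⟩ := Finset.mem_filter.1 hy
      obtain ⟨hyA, hy0, c, hc⟩ := hYmem y hyY
      rw [Fintype.mem_piFinset]
      intro i
      by_cases hi : i ∈ R
      · simp only [D, if_pos hi, maskOn_of_mem hi, Finset.mem_singleton]
      by_cases hi' : i = i₀
      · subst hi'
        simp only [D, if_neg hi, if_true]
        refine Finset.mem_filter.2 ⟨hyA i hi₀T, c, fun j => ?_⟩
        by_cases hj : j ∈ J
        · simp only [v, if_pos hj, hc j hj]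
          exact Finset.sum_congr rfl fun k hk => by rw [maskOn_of_mem (hSR hk)]
        · simp [v, hj]
      · simp only [D, if_neg hi, if_neg hi', Finset.mem_singleton]
        exact hy0 i (by simp [hT, hi, hi'])
    have hW : W.card ≤ e ^ Fintype.card κ * I.card ^ S.card := by
      refine (Finset.card_le_card fun y hy => ?_).trans (card_filter_linearComb_le A
        (fun j x => if j ∈ J then g i₀ j x else 0) hI hAcard (fun j b => ?_) v S)
      · exact hy
      · by_cases hj : j ∈ J
        · simpa only [A, if_pos hj] using hg i₀ j b
        · refine (Finset.card_filter_le _ _).trans ?_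
          simpa only [A, if_neg hj, Finset.card_singleton] using he
    refine (Finset.card_le_card hsub).trans ((card_piFinset_le_pow (J := {i₀})
      (Q := e ^ Fintype.card κ * I.card ^ S.card) (fun i hi => ?_) fun i hi => ?_).trans (by simp))
    · simp only [D]
      split_ifs
      · rw [Finset.card_singleton]
        exact Nat.mul_pos (Nat.pow_pos he) (Nat.pow_pos hI)
      · exact hW
      · rw [Finset.card_singleton]
        exact Nat.mul_pos (Nat.pow_pos he) (Nat.pow_pos hI)
    · rw [Finset.mem_singleton] at hi
      simp only [D, if_neg hi]
      split_ifs <;> simp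
  · have hsub : Y.image (maskOn R) ⊆
        Fintype.piFinset fun i => if i ∈ R then Fintype.piFinset A else {0} := by
      intro a ha
      obtain ⟨y, hy, rfl⟩ := Finset.mem_image.1 ha
      rw [Fintype.mem_piFinset]
      intro i
      by_cases hi : i ∈ R
      · simpa only [if_pos hi, maskOn_of_mem hi] using (hYmem y hy).1 i (hRT hi)
      · simp only [if_neg hi, maskOn_of_notMem hi, Finset.mem_singleton]
    refine (Finset.card_le_card hsub).trans (card_piFinset_le_pow (fun i hi => ?_) fun i hi => ?_)
    · simp only [if_pos hi]
      refine card_piFinset_le_pow (fun j _ => hAcard j) fun j hj => ?_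
      simp only [A, if_neg hj, Finset.card_singleton, le_refl]
    · simp only [if_neg hi, Finset.card_singleton, le_refl]

open Classical in
/-- The number of arrays with a given rank pattern. -/
theorem card_filter_isRankPattern_le (I : Finset ℤ) {e : ℕ} (he : 1 ≤ e) (hI : 1 ≤ I.card)
    {g : ι → κ → ℤ → F} (hg : ∀ i j b, (I.filter fun x => g i j x = b).card ≤ e)
    {R : Finset ι} {J : Finset κ} {i₀ : ι} {S : Finset ι} (hi₀ : i₀ ∉ R) (hSR : S ⊆ R) {B : ℕ}
    (hB : ∀ j, ∀ c : ι → F, (∀ k ∈ S, c k ≠ 0) →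
      (colSols I (insert i₀ R) (fun i => g i j) i₀ S c).card ≤ B) :
    ((Fintype.piFinset fun _ : ι => Fintype.piFinset fun _ : κ => I).filter
      (IsRankPattern g R J i₀ S)).card ≤
    (2 ^ Fintype.card ι * (e ^ Fintype.card κ * I.card ^ S.card)) ^
        (Fintype.card ι - (R.card + 1)) *
      (B ^ (Fintype.card κ - J.card) *
        (e ^ Fintype.card κ * I.card ^ S.card * (I.card ^ J.card) ^ R.card)) :=
  (card_filter_le_of_rows I hI hg hi₀).trans <| Nat.mul_le_mul_left _ <|
    (card_image_mask_le_of_cols I hSR hB).trans <| Nat.mul_le_mul_left _ <|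
      card_image_mask_minor_le I he hI hg hSR

/-- Every matrix of rank `r` with more than `r` rows has a rank pattern. -/
theorem exists_isRankPattern {g : ι → κ → ℤ → F} {x : ι → κ → ℤ} {r : ℕ}
    (hr : (Matrix.of fun i j => g i j (x i j)).rank = r) (hrι : r < Fintype.card ι) :
    ∃ (R : Finset ι) (J : Finset κ) (i₀ : ι) (S : Finset ι), R.card = r ∧ J.card = r ∧ i₀ ∉ R ∧
      S ⊆ R ∧ IsRankPattern g R J i₀ S x := by
  classical
  set M : Matrix ι κ F := Matrix.of fun i j => g i j (x i j) with hM
  obtain ⟨R, hR, hspan⟩ := exists_finset_linearIndepOn_spanning (F := F) M.row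
  set W := Submodule.span F (Set.range M.row) with hW
  have hWr : Module.finrank F W = r := by rw [← hr, Matrix.rank_eq_finrank_span_row]
  have hRW : R.card = r := by
    have h1 : Submodule.span F (M.row '' (R : Set ι)) = W := by
      refine le_antisymm (Submodule.span_mono (Set.image_subset_range _ _)) ?_
      rw [hW, Submodule.span_le]
      rintro _ ⟨i, rfl⟩
      exact (Submodule.mem_span_image_finset_iff_exists_fun' F).2 (hspan i)
    rw [← hWr, ← h1, Set.image_eq_range]
    have := finrank_span_eq_card hR
    simpa using this.symm
  obtain ⟨J, hJ, hinj⟩ := exists_finset_card_eq_finrank_injOn W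
  choose c hc using hspan
  have hc' : ∀ i j, g i j (x i j) = ∑ k ∈ R.filter (fun k => c i k ≠ 0), c i k * g k j (x k j) := by
    intro i j
    have := congrFun (hc i) j
    simp only [Finset.sum_apply, Pi.smul_apply, smul_eq_mul, Matrix.row_apply, hM,
      Matrix.of_apply] at this
    rw [← this]
    exact (Finset.sum_filter_of_ne (p := fun k => c i k ≠ 0)
      fun k _ hk h => hk (by rw [h, zero_mul])).symm
  have hne : Rᶜ.Nonempty := by
    rw [← Finset.card_pos, Finset.card_compl]
    omega
  -- Maximality of the support of row `i₀` is what bounds the support of every other row by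
  -- `S.card`.
  obtain ⟨i₀, hi₀, hmax⟩ := Finset.exists_max_image Rᶜ
    (fun i => (R.filter fun k => c i k ≠ 0).card) hne
  refine ⟨R, J, i₀, R.filter fun k => c i₀ k ≠ 0, hRW, hJ.trans hWr, Finset.mem_compl.1 hi₀,
    Finset.filter_subset _ _, fun d hd => ?_, ⟨c i₀, fun k hk => (Finset.mem_filter.1 hk).2,
      hc' i₀⟩, fun i hi => ⟨_, Finset.filter_subset _ _, hmax i (Finset.mem_compl.2 hi), c i,
        hc' i⟩⟩
  -- A combination of rows that vanishes on `J` is zero, as the row space projects injectively to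
  -- `J`; independence of `R` then kills its coefficients.
  refine linearIndepOn_finset_iff.1 hR d (hinj _ ?_ fun j hj => ?_)
  · exact Submodule.sum_mem _ fun k _ => Submodule.smul_mem _ _ (Submodule.subset_span ⟨k, rfl⟩)
  · simpa [Finset.sum_apply, Matrix.row_apply, hM] using hd j hj

end Counting

/-! ### Exponents and conclusion. -/

/-- The exponent of `H` in the number of columns satisfying a relation with `s` terms. -/
noncomputable def columnExponent (r s : ℕ) : ℝ := if s ≤ 1 then r else if s = 2 then r - 1 / 2 else r - 1

/-- For `s ≤ 1` and `s = 2` the excess over `m + n r - r` is at most the first, respectively second,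
term of `Γ`. For `s ≥ 3` the left side increases with `s`, and `s = r` gives the third term. -/
theorem columnExponent_bound {m n r s : ℕ} (hr : 3 ≤ r) (hrm : r ≤ m) (hrn : r ≤ n) (hs : s ≤ r) :
    (s : ℝ) * (m - r) + r * r + (n - r) * columnExponent r s ≤
      m + n * r - r + gammaExponent m n r := by
  have h3 : (3 : ℝ) ≤ r := by exact_mod_cast hr
  have hm : (r : ℝ) ≤ m := by exact_mod_cast hrm
  have hn : (r : ℝ) ≤ n := by exact_mod_cast hrn
  have hs' : (s : ℝ) ≤ r := by exact_mod_cast hs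
  have hΓ0 : 0 ≤ gammaExponent m n r := le_max_left _ _
  have hΓ1 : (m : ℝ) - ((n : ℝ) + r) / 2 ≤ gammaExponent m n r :=
    (le_max_left _ _).trans (le_max_right _ _)
  have hΓ2 : (m : ℝ) * ((r : ℝ) - 1) - n - (r : ℝ) * ((r : ℝ) - 2) ≤ gammaExponent m n r :=
    (le_max_right _ _).trans (le_max_right _ _)
  unfold columnExponent
  split_ifs with h1 h2
  · have : (s : ℝ) ≤ 1 := by exact_mod_cast h1
    nlinarith
  · subst h2
    push_cast
    nlinarith
  · nlinarith

theorem two_mul_lt_of_pow_le {e H p : ℕ} (he : 2 ≤ e) (hH : 2 ≤ H) (hHp : H ^ (e * (e + 1)) ≤ p ^ 2) :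
    2 * H < p := by
  have h1 : H ^ 3 ≤ p := by
    refine (Nat.pow_le_pow_iff_left (n := 2) (by norm_num)).1 (le_trans ?_ hHp)
    rw [← pow_mul]
    exact Nat.pow_le_pow_right (by omega) (by nlinarith)
  refine lt_of_lt_of_le ?_ h1
  have : 2 * 2 ≤ H * H := Nat.mul_le_mul hH hH
  calc 2 * H < (2 * 2) * H := by omega
    _ ≤ (H * H) * H := Nat.mul_le_mul_right _ this
    _ = H ^ 3 := by ring

section Bounds

variable {e : ℕ} {H p : ℕ} [Fact p.Prime]

theorem injOn_intCast_zmod_Icc (h : 2 * H < p) :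
    Set.InjOn (fun x : ℤ => (x : ZMod p)) (Finset.Icc (-H : ℤ) H) := by
  intro x hx y hy hxy
  rw [Finset.mem_coe, Finset.mem_Icc] at hx hy
  have h0 : ((x - y : ℤ) : ZMod p) = 0 := by
    push_cast
    exact sub_eq_zero.2 hxy
  rw [ZMod.intCast_zmod_eq_zero_iff_dvd] at h0
  have := Int.eq_zero_of_abs_lt_dvd h0 (by rw [abs_lt]; constructor <;> omega)
  omega

/-- Three-term additive equations, by Cauchy–Schwarz from four-term ones. -/
theorem card_tripleSols_le_rpow {C δ : ℝ} (hC : 1 ≤ C) (hδ : 0 < δ) (he : 1 ≤ e) (hH : 1 ≤ H)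
    (hinj : Set.InjOn (fun x : ℤ => (x : ZMod p)) (Finset.Icc (-H : ℤ) H))
    (hquad : ∀ f₁ f₂ f₃ f₄ : (ZMod p)[X],
      (∀ f ∈ ({f₁, f₂, f₃, f₄} : Set (ZMod p)[X]), 2 ≤ f.natDegree ∧ f.natDegree ≤ e) →
      ((quadSols (Finset.Icc (-H : ℤ) H) (Finset.Icc (-H : ℤ) H) (Finset.Icc (-H : ℤ) H)
        (Finset.Icc (-H : ℤ) H) (fun x => f₁.eval (x : ZMod p)) (fun x => f₂.eval (x : ZMod p))
        (fun x => f₃.eval (x : ZMod p)) (fun x => f₄.eval (x : ZMod p))).card : ℝ) ≤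
        C * (H : ℝ) ^ (2 + δ))
    {f₁ f₂ f₃ : (ZMod p)[X]}
    (hf : ∀ f ∈ ({f₁, f₂, f₃} : Set (ZMod p)[X]), 2 ≤ f.natDegree ∧ f.natDegree ≤ e) :
    ((tripleSols (Finset.Icc (-H : ℤ) H) (fun x => f₁.eval (x : ZMod p))
      (fun x => f₂.eval (x : ZMod p)) (fun x => f₃.eval (x : ZMod p))).card : ℝ) ≤
      3 * e * C * (H : ℝ) ^ (3 / 2 + δ) := by
  have hH' : (1 : ℝ) ≤ H := by exact_mod_cast hH
  have he' : (1 : ℝ) ≤ e := by exact_mod_cast he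
  have hf₁ := hf f₁ (by simp)
  have hf₂ := hf f₂ (by simp)
  have hf₃ := hf f₃ (by simp)
  have h1 := sq_card_tripleSols_le (Finset.Icc (-H : ℤ) H) (fun x => f₁.eval (x : ZMod p))
    (fun x => f₂.eval (x : ZMod p)) (fun x => f₃.eval (x : ZMod p))
  have h2 := hquad f₁ f₂ f₁ f₂ (by
    intro f hf
    simp only [Set.mem_insert_iff, Set.mem_singleton_iff] at hf
    rcases hf with rfl | rfl | rfl | rfl <;> assumption)
  have h3 := card_pairs_eval_eq_le (P := f₃) (by omega) _ hinj
  have hcard : (Finset.Icc (-H : ℤ) H).card = 2 * H + 1 := by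
    rw [Int.card_Icc]
    omega
  have h4 : (((Finset.Icc (-H : ℤ) H ×ˢ Finset.Icc (-H : ℤ) H).filter
      fun z => f₃.eval (z.1 : ZMod p) = f₃.eval (z.2 : ZMod p)).card : ℝ) ≤ e * (3 * H) := by
    have : _ ≤ e * (3 * H) := h3.trans (Nat.mul_le_mul hf₃.2 (by omega))
    exact_mod_cast this
  refine (pow_le_pow_iff_left₀ (Nat.cast_nonneg _) (by positivity) (two_ne_zero)).1 ?_
  calc _ ≤ _ := by exact_mod_cast h1
    _ ≤ (C * (H : ℝ) ^ (2 + δ)) * (e * (3 * H)) := mul_le_mul h2 h4 (by positivity) (by positivity)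
    _ = (3 * e * C) * 1 * ((H : ℝ) ^ (2 + δ) * (H : ℝ) ^ (1 : ℝ)) := by rw [Real.rpow_one]; ring
    _ = (3 * e * C) * 1 * (H : ℝ) ^ (3 + δ) := by
        rw [← Real.rpow_add (by positivity)]
        congr 2
        ring
    -- Cauchy–Schwarz gives the exponent `3 / 2 + δ / 2`; enlarging the constant and the exponent
    -- makes the bound a perfect square.
    _ ≤ (3 * e * C) * (3 * e * C) * (H : ℝ) ^ (3 + δ + δ) := by
        have : (1 : ℝ) ≤ 3 * e * C := by nlinarith
        gcongr
        linarith
    _ = _ := by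
        rw [mul_pow, ← Real.rpow_two, ← Real.rpow_two ((H : ℝ) ^ _), ← Real.rpow_mul (by positivity),
          Real.rpow_two]
        ring_nf

/-- Of the `r + 1` entries (`r = R.card`), a relation with at most one term leaves `r` free. Two
terms give `H^(3/2)` for three entries and `r - 2` free ones; at least three terms give `H^2` for
four entries and `r - 3` free ones. -/
theorem card_colSols_le_rpow {C δ : ℝ} (hC : 1 ≤ C) (hδ : 0 < δ) (he : 1 ≤ e) (hH : 1 ≤ H)
    (hinj : Set.InjOn (fun x : ℤ => (x : ZMod p)) (Finset.Icc (-H : ℤ) H))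
    (hquad : ∀ f₁ f₂ f₃ f₄ : (ZMod p)[X],
      (∀ f ∈ ({f₁, f₂, f₃, f₄} : Set (ZMod p)[X]), 2 ≤ f.natDegree ∧ f.natDegree ≤ e) →
      ((quadSols (Finset.Icc (-H : ℤ) H) (Finset.Icc (-H : ℤ) H) (Finset.Icc (-H : ℤ) H)
        (Finset.Icc (-H : ℤ) H) (fun x => f₁.eval (x : ZMod p)) (fun x => f₂.eval (x : ZMod p))
        (fun x => f₃.eval (x : ZMod p)) (fun x => f₄.eval (x : ZMod p))).card : ℝ) ≤
        C * (H : ℝ) ^ (2 + δ))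
    {ι : Type*} [Fintype ι] [DecidableEq ι] {f : ι → (ZMod p)[X]}
    (hf : ∀ i, 2 ≤ (f i).natDegree ∧ (f i).natDegree ≤ e) {R S : Finset ι} {i₀ : ι}
    (hi₀ : i₀ ∉ R) (hSR : S ⊆ R) {c : ι → ZMod p} (hc : ∀ k ∈ S, c k ≠ 0) (hR : 3 ≤ R.card) :
    ((colSols (Finset.Icc (-H : ℤ) H) (insert i₀ R) (fun i x => (f i).eval (x : ZMod p)) i₀ S
      c).card : ℝ) ≤
      3 * e * C * 3 ^ R.card * (H : ℝ) ^ (columnExponent R.card S.card + δ) := by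
  have hH' : (1 : ℝ) ≤ H := by exact_mod_cast hH
  have he' : (1 : ℝ) ≤ e := by exact_mod_cast he
  have hcard : (Finset.Icc (-H : ℤ) H).card = 2 * H + 1 := by
    rw [Int.card_Icc]
    omega
  have hI : ∀ k ≤ R.card, (((Finset.Icc (-H : ℤ) H).card ^ k : ℕ) : ℝ) ≤
      3 ^ R.card * (H : ℝ) ^ (k : ℝ) := by
    intro k hk
    rw [Real.rpow_natCast]
    calc (((Finset.Icc (-H : ℤ) H).card ^ k : ℕ) : ℝ) ≤ (3 * H : ℝ) ^ k := by
          rw [hcard]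
          push_cast
          gcongr
          linarith
      _ = 3 ^ k * (H : ℝ) ^ k := mul_pow _ _ _
      _ ≤ _ := by
          gcongr
          norm_num
  have hT : (insert i₀ R).card = R.card + 1 := Finset.card_insert_of_notMem hi₀
  have h₀ : i₀ ∈ insert i₀ R := Finset.mem_insert_self _ _
  have hS : i₀ ∉ S := fun h => hi₀ (hSR h)
  have hST : S ⊆ insert i₀ R := hSR.trans (Finset.subset_insert _ _)
  unfold columnExponent
  split_ifs with h1 h2
  · have h := card_colSols_le_of_fiber (Finset.Icc (-H : ℤ) H) (T := insert i₀ R)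
      (fun i x => (f i).eval (x : ZMod p)) c h₀ hS (e := e) fun b =>
        (card_filter_eval_eq_le (by have := (hf i₀).1; omega) _ hinj b).trans (hf i₀).2
    rw [hT, Nat.add_sub_cancel] at h
    calc _ ≤ ((e * (Finset.Icc (-H : ℤ) H).card ^ R.card : ℕ) : ℝ) := by exact_mod_cast h
      _ = e * (((Finset.Icc (-H : ℤ) H).card ^ R.card : ℕ) : ℝ) := by push_cast; ring
      _ ≤ e * (3 ^ R.card * (H : ℝ) ^ (R.card : ℝ)) := by gcongr; exact hI _ le_rfl
      _ = e * 3 ^ R.card * (H : ℝ) ^ (R.card : ℝ) := by ring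
      _ ≤ _ := by
          gcongr
          · nlinarith
          · linarith
  · obtain ⟨k₁, k₂, h₁₂, rfl⟩ := Finset.card_eq_two.1 h2
    have h := card_colSols_le_of_triple (Finset.Icc (-H : ℤ) H)
      (N := ⌊3 * e * C * (H : ℝ) ^ (3 / 2 + δ)⌋₊) (fun f₁ f₂ f₃ hf' => Nat.le_floor
        (card_tripleSols_le_rpow hC hδ he hH hinj hquad hf')) hf h₀ hS hST hc
        (k₁ := k₁) (k₂ := k₂) (by simp) (by simp) h₁₂
    rw [hT, show R.card + 1 - 3 = R.card - 2 by omega] at h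
    calc _ ≤ ((⌊3 * e * C * (H : ℝ) ^ (3 / 2 + δ)⌋₊ *
          (Finset.Icc (-H : ℤ) H).card ^ (R.card - 2) : ℕ) : ℝ) := by exact_mod_cast h
      _ = (⌊3 * e * C * (H : ℝ) ^ (3 / 2 + δ)⌋₊ : ℝ) *
          (((Finset.Icc (-H : ℤ) H).card ^ (R.card - 2) : ℕ) : ℝ) := by push_cast; ring
      _ ≤ (3 * e * C * (H : ℝ) ^ (3 / 2 + δ)) *
          (3 ^ R.card * (H : ℝ) ^ ((R.card - 2 : ℕ) : ℝ)) :=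
          mul_le_mul (Nat.floor_le (by positivity)) (hI _ (by omega)) (by positivity)
            (by positivity)
      _ = 3 * e * C * 3 ^ R.card *
          ((H : ℝ) ^ (3 / 2 + δ) * (H : ℝ) ^ ((R.card - 2 : ℕ) : ℝ)) := by ring
      _ = _ := by
          rw [← Real.rpow_add (by positivity), Nat.cast_sub (by omega)]
          congr 2
          push_cast
          ring
  · obtain ⟨k₁, k₂, k₃, h₁, h₂, h₃, h₁₂, h₁₃, h₂₃⟩ :=
      Finset.two_lt_card_iff.1 (show 2 < S.card by omega)
    have h := card_colSols_le_of_quad (Finset.Icc (-H : ℤ) H)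
      (N := ⌊C * (H : ℝ) ^ (2 + δ)⌋₊) (fun f₁ f₂ f₃ f₄ hf' => Nat.le_floor
        (hquad f₁ f₂ f₃ f₄ hf')) hf h₀ hS hST hc h₁ h₂ h₃ h₁₂ h₁₃ h₂₃
    rw [hT, show R.card + 1 - 4 = R.card - 3 by omega] at h
    calc _ ≤ ((⌊C * (H : ℝ) ^ (2 + δ)⌋₊ *
          (Finset.Icc (-H : ℤ) H).card ^ (R.card - 3) : ℕ) : ℝ) := by exact_mod_cast h
      _ = (⌊C * (H : ℝ) ^ (2 + δ)⌋₊ : ℝ) *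
          (((Finset.Icc (-H : ℤ) H).card ^ (R.card - 3) : ℕ) : ℝ) := by push_cast; ring
      _ ≤ (C * (H : ℝ) ^ (2 + δ)) * (3 ^ R.card * (H : ℝ) ^ ((R.card - 3 : ℕ) : ℝ)) :=
          mul_le_mul (Nat.floor_le (by positivity)) (hI _ (by omega)) (by positivity)
            (by positivity)
      _ = 1 * C * 3 ^ R.card * ((H : ℝ) ^ (2 + δ) * (H : ℝ) ^ ((R.card - 3 : ℕ) : ℝ)) := by ring
      _ ≤ 3 * e * C * 3 ^ R.card *
          ((H : ℝ) ^ (2 + δ) * (H : ℝ) ^ ((R.card - 3 : ℕ) : ℝ)) := by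
          gcongr
          linarith
      _ = _ := by
          rw [← Real.rpow_add (by positivity), Nat.cast_sub (by omega)]
          congr 2
          push_cast
          ring

end Bounds

/-- The number of arrays in `[-H, H]` with a given rank pattern. -/
theorem card_filter_isRankPattern_le_rpow {m n r e H p : ℕ} [Fact p.Prime] {C δ : ℝ} (hC : 1 ≤ C)
    (hδ : 0 < δ) (he : 1 ≤ e) (hH : 1 ≤ H) (hr : 3 ≤ r) (hrm : r < m) (hrn : r ≤ n)
    (hinj : Set.InjOn (fun x : ℤ => (x : ZMod p)) (Finset.Icc (-H : ℤ) H))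
    (hquad : ∀ f₁ f₂ f₃ f₄ : (ZMod p)[X],
      (∀ f ∈ ({f₁, f₂, f₃, f₄} : Set (ZMod p)[X]), 2 ≤ f.natDegree ∧ f.natDegree ≤ e) →
      ((quadSols (Finset.Icc (-H : ℤ) H) (Finset.Icc (-H : ℤ) H) (Finset.Icc (-H : ℤ) H)
        (Finset.Icc (-H : ℤ) H) (fun x => f₁.eval (x : ZMod p)) (fun x => f₂.eval (x : ZMod p))
        (fun x => f₃.eval (x : ZMod p)) (fun x => f₄.eval (x : ZMod p))).card : ℝ) ≤
        C * (H : ℝ) ^ (2 + δ))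
    {f : Matrix (Fin m) (Fin n) (ZMod p)[X]}
    (hf : ∀ i j, 2 ≤ (f i j).natDegree ∧ (f i j).natDegree ≤ e)
    {R : Finset (Fin m)} {J : Finset (Fin n)} {i₀ : Fin m} {S : Finset (Fin m)} (hR : R.card = r)
    (hJ : J.card = r) (hi₀ : i₀ ∉ R) (hSR : S ⊆ R)
    {g : Fin m → Fin n → ℤ → ZMod p} (hg : g = fun i j (x : ℤ) => (f i j).eval (x : ZMod p))
    [DecidablePred (IsRankPattern g R J i₀ S)] :
    (((intBox m n H).filter (IsRankPattern g R J i₀ S)).card : ℝ) ≤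
    ((2 ^ m * (e ^ n * 3 ^ r)) ^ (m - (r + 1)) * ((3 * e * C * 3 ^ r) ^ (n - r) *
      (e ^ n * 3 ^ r * (3 ^ r) ^ r))) *
      (H : ℝ) ^ (m + n * r - r + gammaExponent m n r + n * δ) := by
  have hH' : (1 : ℝ) ≤ H := by exact_mod_cast hH
  set s := S.card with hs
  have hsr : s ≤ r := hR ▸ Finset.card_le_card hSR
  set I := Finset.Icc (-H : ℤ) H with hI
  have hcard : I.card = 2 * H + 1 := by
    rw [hI, Int.card_Icc]
    omega
  set E := 3 * e * C * 3 ^ r * (H : ℝ) ^ (columnExponent r s + δ) with hE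
  have hB : ∀ j, ∀ c : Fin m → ZMod p, (∀ k ∈ S, c k ≠ 0) →
      (colSols I (insert i₀ R) (fun i => g i j) i₀ S c).card ≤ ⌊E⌋₊ := by
    intro j c hc
    refine Nat.le_floor ?_
    have := card_colSols_le_rpow hC hδ he hH hinj hquad (f := fun i => f i j)
      (fun i => hf i j) hi₀ hSR hc (by omega)
    rw [hR] at this
    simpa only [hg] using this
  have hfib : ∀ i j b, (I.filter fun x => g i j x = b).card ≤ e := by
    intro i j b
    rw [hg]
    exact (card_filter_eval_eq_le (by have := (hf i j).1; omega) I hinj b).trans (hf i j).2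
  have hpat := card_filter_isRankPattern_le I he (by omega) (g := g) (fun i j b => by convert hfib i j b)
    (R := R) (J := J) hi₀ hSR (B := ⌊E⌋₊) (fun j c hc => by convert hB j c hc)
  rw [Fintype.card_fin, Fintype.card_fin, hR, hJ, hcard] at hpat
  have hmain : ((intBox m n H).filter (IsRankPattern g R J i₀ S)).card ≤
      (2 ^ m * (e ^ n * (2 * H + 1) ^ s)) ^ (m - (r + 1)) * (⌊E⌋₊ ^ (n - r) *
        (e ^ n * (2 * H + 1) ^ s * ((2 * H + 1) ^ r) ^ r)) := by
    unfold intBox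
    convert hpat
  have hQ : ((2 * H + 1 : ℕ) : ℝ) ≤ 3 * H := by
    push_cast
    linarith
  have hQs : ((2 * H + 1 : ℕ) : ℝ) ^ s ≤ 3 ^ r * (H : ℝ) ^ s := by
    calc ((2 * H + 1 : ℕ) : ℝ) ^ s ≤ (3 * H : ℝ) ^ s := by gcongr
      _ = 3 ^ s * (H : ℝ) ^ s := mul_pow _ _ _
      _ ≤ _ := by
        gcongr
        norm_num
  have hfl : (⌊E⌋₊ : ℝ) ≤ E := Nat.floor_le (by positivity)
  have hexp : (s : ℝ) * (m - r) + r * r + (n - r) * (columnExponent r s + δ) ≤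
      m + n * r - r + gammaExponent m n r + n * δ := by
    have := columnExponent_bound (m := m) (n := n) hr hrm.le hrn hsr
    have h2 : 0 ≤ (r : ℝ) * δ := by positivity
    linarith
  calc _ ≤ (((2 ^ m * (e ^ n * (2 * H + 1) ^ s)) ^ (m - (r + 1)) * (⌊E⌋₊ ^ (n - r) *
        (e ^ n * (2 * H + 1) ^ s * ((2 * H + 1) ^ r) ^ r)) : ℕ) : ℝ) := by exact_mod_cast hmain
    _ = (2 ^ m * (e ^ n * ((2 * H + 1 : ℕ) : ℝ) ^ s)) ^ (m - (r + 1)) * ((⌊E⌋₊ : ℝ) ^ (n - r) *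
        (e ^ n * ((2 * H + 1 : ℕ) : ℝ) ^ s * (((2 * H + 1 : ℕ) : ℝ) ^ r) ^ r)) := by push_cast; ring
    _ ≤ (2 ^ m * (e ^ n * (3 ^ r * (H : ℝ) ^ s))) ^ (m - (r + 1)) * (E ^ (n - r) *
        (e ^ n * (3 ^ r * (H : ℝ) ^ s) * ((3 * (H : ℝ)) ^ r) ^ r)) := by gcongr
    _ = ((2 ^ m * (e ^ n * 3 ^ r)) ^ (m - (r + 1)) * ((3 * e * C * 3 ^ r) ^ (n - r) *
        (e ^ n * 3 ^ r * (3 ^ r) ^ r))) * (((H : ℝ) ^ s) ^ (m - (r + 1)) *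
          ((H : ℝ) ^ (columnExponent r s + δ)) ^ (n - r) * ((H : ℝ) ^ s * ((H : ℝ) ^ r) ^ r)) := by
        rw [hE]
        simp only [mul_pow]
        ring
    _ = ((2 ^ m * (e ^ n * 3 ^ r)) ^ (m - (r + 1)) * ((3 * e * C * 3 ^ r) ^ (n - r) *
        (e ^ n * 3 ^ r * (3 ^ r) ^ r))) *
        (H : ℝ) ^ ((s : ℝ) * (m - r) + r * r + (n - r) * (columnExponent r s + δ)) := by
        congr 1
        rw [← pow_mul, ← pow_mul, ← Real.rpow_natCast, ← Real.rpow_natCast, ← Real.rpow_natCast,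
          ← Real.rpow_natCast (H : ℝ) (r * r), ← Real.rpow_mul (by positivity),
          ← Real.rpow_add (by positivity), ← Real.rpow_add (by positivity),
          ← Real.rpow_add (by positivity)]
        congr 1
        push_cast [Nat.cast_sub (show r + 1 ≤ m by omega), Nat.cast_sub hrn]
        ring
    _ ≤ _ := by
        gcongr

theorem pow_le_sq_of_le_rpow {e H p : ℕ} (he : 1 ≤ e)
    (h : (H : ℝ) ≤ (p : ℝ) ^ ((2 : ℝ) / ((e : ℝ) * ((e : ℝ) + 1)))) :
    H ^ (e * (e + 1)) ≤ p ^ 2 := by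
  have he' : (0 : ℝ) < e := by exact_mod_cast he
  have : (H : ℝ) ^ (e * (e + 1)) ≤ (p : ℝ) ^ 2 := by
    calc (H : ℝ) ^ (e * (e + 1)) ≤
          ((p : ℝ) ^ ((2 : ℝ) / ((e : ℝ) * ((e : ℝ) + 1)))) ^ (e * (e + 1)) := by gcongr
      _ = (p : ℝ) ^ 2 := by
        rw [← Real.rpow_natCast, ← Real.rpow_mul (by positivity), ← Real.rpow_natCast]
        congr 1
        push_cast
        field_simp
  exact_mod_cast this

theorem eventually_const_mul_rpow_le {K η : ℝ} (hη : 0 < η) (T : ℝ) :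
    ∀ᶠ H : ℕ in atTop, K * (H : ℝ) ^ T ≤ (H : ℝ) ^ (T + η) := by
  have h := ((tendsto_rpow_atTop hη).comp tendsto_natCast_atTop_atTop).eventually_ge_atTop K
  filter_upwards [h, eventually_ge_atTop 1] with H hH hH1
  have hH0 : (0 : ℝ) < H := by exact_mod_cast hH1
  rw [Real.rpow_add hH0, mul_comm]
  gcongr
  exact hH

theorem card_intBox (m n H : ℕ) : (intBox m n H).card = (2 * H + 1) ^ (n * m) := by
  have : (Finset.Icc (-H : ℤ) H).card = 2 * H + 1 := by
    rw [Int.card_Icc]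
    omega
  simp [intBox, Fintype.card_piFinset, this, pow_mul]

theorem theorem2p7 (m n r e : ℕ) (hr : 3 ≤ r) (hrm : r ≤ m) (hmn : m ≤ n) :
    ∀ ε : ℝ, 0 < ε → ∀ᶠ H : ℕ in atTop,
      ∀ p : ℕ, p.Prime → (H : ℝ) ≤ (p : ℝ) ^ ((2 : ℝ) / ((e : ℝ) * ((e : ℝ) + 1))) →
        ∀ f : Matrix (Fin m) (Fin n) (ZMod p)[X],
          (∀ i j, 2 ≤ (f i j).natDegree ∧ (f i j).natDegree ≤ e) →
            (rankCount f r H : ℝ) ≤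
              (H : ℝ) ^ ((m : ℝ) + (n : ℝ) * r - r + gammaExponent m n r + ε) := by
  classical
  intro ε hε
  -- For `e < 2` no matrix satisfies the degree condition, as it has at least one entry.
  rcases lt_or_ge e 2 with he | he
  · refine Eventually.of_forall fun H p _ _ f hf => ?_
    have := hf ⟨0, by omega⟩ ⟨0, by omega⟩
    omega
  rcases hrm.eq_or_lt with rfl | hrm
  · filter_upwards [eventually_const_mul_rpow_le (K := 3 ^ (n * r)) hε ((n * r : ℕ) : ℝ),
      eventually_ge_atTop 1] with H hH hH1 p hp hHp f hf
    have hH' : (1 : ℝ) ≤ H := by exact_mod_cast hH1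
    calc (rankCount f r H : ℝ) ≤ (((2 * H + 1) ^ (n * r) : ℕ) : ℝ) := by
          exact_mod_cast (Finset.card_filter_le _ _).trans (card_intBox r n H).le
      _ = (2 * (H : ℝ) + 1) ^ (n * r) := by push_cast; ring
      _ ≤ (3 * (H : ℝ)) ^ (n * r) := by
          gcongr
          linarith
      _ = 3 ^ (n * r) * (H : ℝ) ^ ((n * r : ℕ) : ℝ) := by rw [mul_pow, Real.rpow_natCast]
      _ ≤ _ := hH
      _ ≤ _ := by
          have : 0 ≤ gammaExponent r n r := le_max_left _ _
          refine Real.rpow_le_rpow_of_exponent_le hH' ?_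
          push_cast
          linarith
  have hn0 : (0 : ℝ) < n := by exact_mod_cast (show 0 < n by omega)
  -- The column bounds lose at most `n δ = ε / 2`; the other half of `ε` absorbs the constant and
  -- the number `D₀` of possible patterns.
  set δ : ℝ := ε / (2 * n) with hδdef
  have hδ : 0 < δ := by positivity
  have hnδ : n * δ = ε / 2 := by
    rw [hδdef]
    field_simp
  obtain ⟨C, hC, hquad⟩ := exists_card_quadSols_le he hδ
  set K₀ : ℝ := (2 ^ m * (e ^ n * 3 ^ r)) ^ (m - (r + 1)) * ((3 * e * C * 3 ^ r) ^ (n - r) *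
      (e ^ n * 3 ^ r * (3 ^ r) ^ r)) with hK₀
  set T : ℝ := (m : ℝ) + (n : ℝ) * r - r + gammaExponent m n r + n * δ with hT
  set D₀ : ℕ := Fintype.card (Finset (Fin m) × Finset (Fin n) × Fin m × Finset (Fin m)) with hD₀
  filter_upwards [eventually_const_mul_rpow_le (K := D₀ * K₀) (half_pos hε) T,
    eventually_ge_atTop e] with H hH heH p hp hHp f hf
  have : Fact p.Prime := ⟨hp⟩
  have hpow := pow_le_sq_of_le_rpow (by omega) hHp
  have hinj := injOn_intCast_zmod_Icc (two_mul_lt_of_pow_le he (by omega) hpow)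
  set g : Fin m → Fin n → ℤ → ZMod p := fun i j x => (f i j).eval (x : ZMod p) with hg
  let D : Finset (Finset (Fin m) × Finset (Fin n) × Fin m × Finset (Fin m)) :=
    Finset.univ.filter fun d => d.1.card = r ∧ d.2.1.card = r ∧ d.2.2.1 ∉ d.1 ∧ d.2.2.2 ⊆ d.1
  have hsub : ((intBox m n H).filter fun x => (polyMatrixEval f x).rank = r) ⊆
      D.biUnion fun d => (intBox m n H).filter (IsRankPattern g d.1 d.2.1 d.2.2.1 d.2.2.2) := by
    intro x hx
    rw [Finset.mem_filter] at hx
    obtain ⟨R, J, i₀, S, hR, hJ, hi₀, hSR, hpat⟩ := exists_isRankPattern (g := g) hx.2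
      (by simpa using hrm)
    rw [Finset.mem_biUnion]
    exact ⟨(R, J, i₀, S), Finset.mem_filter.2 ⟨Finset.mem_univ _, hR, hJ, hi₀, hSR⟩,
      Finset.mem_filter.2 ⟨hx.1, hpat⟩⟩
  have hbound : ∀ d ∈ D, (((intBox m n H).filter
      (IsRankPattern g d.1 d.2.1 d.2.2.1 d.2.2.2)).card : ℝ) ≤ K₀ * (H : ℝ) ^ T := by
    intro d hd
    obtain ⟨-, hR, hJ, hi₀, hSR⟩ := Finset.mem_filter.1 hd
    exact card_filter_isRankPattern_le_rpow hC hδ (by omega) (by omega) hr hrm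
      (hrm.le.trans hmn) hinj (hquad H p heH inferInstance hpow) hf hR hJ hi₀ hSR hg
  have hK₀0 : 0 ≤ K₀ := by positivity
  calc (rankCount f r H : ℝ) ≤ ((∑ d ∈ D, ((intBox m n H).filter
        (IsRankPattern g d.1 d.2.1 d.2.2.1 d.2.2.2)).card : ℕ) : ℝ) := by
        exact_mod_cast (Finset.card_le_card hsub).trans Finset.card_biUnion_le
    _ ≤ ∑ _d ∈ D, K₀ * (H : ℝ) ^ T := by
        push_cast
        exact Finset.sum_le_sum hbound
    _ = D.card * (K₀ * (H : ℝ) ^ T) := by rw [Finset.sum_const, nsmul_eq_mul]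
    _ ≤ D₀ * (K₀ * (H : ℝ) ^ T) := by
        gcongr
        exact Finset.card_le_univ D
    _ = D₀ * K₀ * (H : ℝ) ^ T := by ring
    _ ≤ _ := hH
    _ = _ := by
        congr 1
        rw [hT, hnδ]
        ring
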